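/- **Setting.** Let $N,T_1,T_2\ge 0$ and $M\ge1$ be integers. A linear space-time block code is given by complex $T_2\times 2T_1$ matrices ${\bf A}_j={\bf A}_{jI}+{\bf j}{\bf A}_{jQ}$, $1\le j\le N$ (with ${\bf A}_{jI},{\bf A}_{jQ}$ real), and finite signal sets $\mathcal S_1,\dots,\mathcal S_{T_1}\subset\mathbb C$, from which the symbols $x^{(1)},\dots,x^{(T_1)}$ are taken independently of each other; ${\bf x}=[x^{(1)}_I,x^{(1)}_Q,\dots,x^{(T_1)}_I,x^{(T_1)}_Q]^T\in\mathbb R^{2T_1}$ is the data vector. All channel gains $h_{sj},h_{jd}$ and all noise samples below are independent circularly symmetric complex Gaussian variables of mean $0$ and variance $1$. A function $P(E_t)$ of the energy $E_t$ has *diversity order* $d$ if $-\log P(E_t)/\log E_t\to d$ as $E_t\to\infty$. *Co-located system:* ${\bf y}={\bf H}_{eq}{\bf x}+{\bf z}_d$ with ${\bf H}_{eq}=\sqrt{E_t}\sum_{j}h_{jd}{\bf A}_j$, and maximum likelihood decoding, which minimizes $\|{\bf y}-{\bf H}_{eq}{\bf x}\|^2$. The code *achieves full diversity in the co-located case* if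 for any two distinct data vectors ${\bf x}_1,{\bf x}_2$ the pairwise error probability $P({\bf x}_1\to{\bf x}_2)$ (the probability that, when ${\bf x}_1$ is sent, the metric of ${\bf x}_2$ is at most that of ${\bf x}_1$) has diversity order $N$. *Partially-coherent relay channel (PCRC):* with $E_1=E_t/2$, $E_2=E_t/(2M)$, $G=\sqrt{E_2/(E_1+1)}$, $${\bf y}={\bf H}^{(pc)}_{eq}{\bf x}+\tilde{\bf z}_d,\qquad {\bf H}^{(pc)}_{eq}=G\sqrt{E_1}\sum_{j=1}^N|h_{sj}|h_{jd}{\bf A}_j,\qquad \tilde{\bf z}_d=\sum_{j=1}^N h_{jd}{\bf A}_j\widehat{\bf z}_j+{\bf z}_d,$$ where $\widehat{\bf z}_j\in\mathbb R^{2T_1}$ lists the real and imaginary parts of $G z_j^{(1)},\dots,G z_j^{(T_1)}$, and $z_j^{(i)}$ is the (phase-compensated) noise at relay $j$. The suboptimal decoder minimizes $\|{\bf y}-{\bf H}^{(pc)}_{eq}{\bf x}\|^2$, ignoring the covariance of $\tilde{\bf z}_d$. *SSD conditions:* the matrices $${\bf A}_{jI}^T{\bf A}_{jI}+{\bf A}_{jQ}^T{\bf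 A}_{jQ}\quad(1\le j\le N),$$ $${\bf A}_{jI}^T{\bf A}_{iI}+{\bf A}_{jQ}^T{\bf A}_{iQ}+{\bf A}_{iI}^T{\bf A}_{jI}+{\bf A}_{iQ}^T{\bf A}_{jQ}\quad(i\ne j),$$ $${\bf A}_{jI}^T{\bf A}_{iQ}-{\bf A}_{jQ}^T{\bf A}_{iI}-{\bf A}_{iI}^T{\bf A}_{jQ}+{\bf A}_{iQ}^T{\bf A}_{jI}\quad(i\ne j)$$ are block diagonal with symmetric $2\times2$ blocks. **Theorem 6.** Suppose that the code satisfies the SSD conditions and achieves full diversity in the co-located case with the signal sets $\mathcal S_1,\dots,\mathcal S_{T_1}$. Then, in the PCRC, whether or not the total noise $\tilde{\bf z}_d$ is correlated: 1. for all values of $E_t$, of the gains, of ${\bf y}$ and of ${\bf x}$, $\|{\bf y}-{\bf H}^{(pc)}_{eq}{\bf x}\|^2=\|{\bf y}\|^2+\sum_{l=1}^{T_1}m_l(x^{(l)})$, where $m_l(x^{(l)})$ is the part of $-2{\bf x}^T\Re({\bf H}^{(pc)\mathcal H}_{eq}{\bf y})+{\bf x}^T\Re({\bf H}^{(pc)\mathcal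 H}_{eq}{\bf H}^{(pc)}_{eq}){\bf x}$ that involves the $l$-th symbol only, so that the suboptimal decoder decodes each symbol separately; 2. for any two distinct data vectors ${\bf x}_1,{\bf x}_2$, the pairwise error probability $P({\bf x}_1\to{\bf x}_2)$ of the suboptimal decoder has diversity order $N$; 3. for every data vector ${\bf x}$ sent and every $l$ such that $\mathcal S_l$ has at least two elements, the probability that minimizing $m_l$ over $\mathcal S_l$ gives a wrong $l$-th symbol (ties counted as errors) has diversity order $N$. -/

import Mathlib

open MeasureTheory ProbabilityTheory Filter Topology
open scoped Matrix

namespace PCRC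

noncomputable section

/-- The law `CN(0,1)` on `ℂ`: independent real and imaginary parts, each centred Gaussian of
variance `1/2`. -/
def complexGaussian : Measure ℂ :=
  ((gaussianReal 0 (1 / 2)).prod (gaussianReal 0 (1 / 2))).map
    Complex.measurableEquivRealProd.symm

/-- The real data vector `[x_I⁽¹⁾, x_Q⁽¹⁾, …, x_I⁽ᵀ⁾, x_Q⁽ᵀ⁾]` of a vector of complex symbols. The
coordinate `(l, 0)` is the in-phase part and `(l, 1)` the quadrature part of the `l`-th symbol. -/
def realVec {T₁ : ℕ} (x : Fin T₁ → ℂ) : Fin T₁ × Fin 2 → ℝ :=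
  fun p => ![(x p.1).re, (x p.1).im] p.2

/-- `A x` for a complex matrix `A` and a real vector `x`. -/
def mulRealVec {T₁ T₂ : ℕ} (A : Matrix (Fin T₂) (Fin T₁ × Fin 2) ℂ)
    (x : Fin T₁ × Fin 2 → ℝ) : Fin T₂ → ℂ :=
  A *ᵥ fun p => (x p : ℂ)

/-- Entrywise real part. -/
def matRe {m n : Type*} (A : Matrix m n ℂ) : Matrix m n ℝ := A.map Complex.re

/-- Entrywise imaginary part. -/
def matIm {m n : Type*} (A : Matrix m n ℂ) : Matrix m n ℝ := A.map Complex.im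

/-- Block diagonal with symmetric `2 × 2` blocks, one block for each symbol. -/
def IsSymbolBlockDiagonal {T₁ : ℕ} (D : Matrix (Fin T₁ × Fin 2) (Fin T₁ × Fin 2) ℝ) : Prop :=
  (∀ l l' : Fin T₁, l ≠ l' → ∀ a b : Fin 2, D (l, a) (l', b) = 0) ∧
    ∀ (l : Fin T₁) (a b : Fin 2), D (l, a) (l, b) = D (l, b) (l, a)

/-- The single-symbol decodability conditions for co-located MIMO, in terms of the column vector
representation matrices `A j` of the code. The three matrices are `Re (Aⱼᴴ Aⱼ)`,
`Re (Aⱼᴴ Aᵢ + Aᵢᴴ Aⱼ)` and `Im (Aⱼᴴ Aᵢ - Aᵢᴴ Aⱼ)`. -/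
def SSDConditions {N T₁ T₂ : ℕ} (A : Fin N → Matrix (Fin T₂) (Fin T₁ × Fin 2) ℂ) : Prop :=
  (∀ j, IsSymbolBlockDiagonal
    ((matRe (A j))ᵀ * matRe (A j) + (matIm (A j))ᵀ * matIm (A j))) ∧
  (∀ i j, i ≠ j → IsSymbolBlockDiagonal
    ((matRe (A j))ᵀ * matRe (A i) + (matIm (A j))ᵀ * matIm (A i)
      + (matRe (A i))ᵀ * matRe (A j) + (matIm (A i))ᵀ * matIm (A j))) ∧
  (∀ i j, i ≠ j → IsSymbolBlockDiagonal
    ((matRe (A j))ᵀ * matIm (A i) - (matIm (A j))ᵀ * matRe (A i)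
      - (matRe (A i))ᵀ * matIm (A j) + (matIm (A i))ᵀ * matRe (A j)))

/-- The set of data vectors: the `l`-th symbol ranges over its own finite signal set `S l`,
independently of the others. -/
def signalSet {T₁ : ℕ} (S : Fin T₁ → Finset ℂ) : Set (Fin T₁ → ℂ) :=
  {x | ∀ l, x l ∈ S l}

/-- The metric `‖y - H x‖² = (y - H x)ᴴ (y - H x)`. -/
def euclidMetric {T₁ T₂ : ℕ} (H : Matrix (Fin T₂) (Fin T₁ × Fin 2) ℂ) (y : Fin T₂ → ℂ)
    (x : Fin T₁ → ℂ) : ℝ :=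
  ∑ t, ‖y t - mulRealVec H (realVec x) t‖ ^ 2

/-- The part of `-2 xᵀ Re (Hᴴ y) + xᵀ Re (Hᴴ H) x` that involves the `l`-th symbol only, at the
value `s` of this symbol. -/
def symbolMetric {T₁ T₂ : ℕ} (H : Matrix (Fin T₂) (Fin T₁ × Fin 2) ℂ) (y : Fin T₂ → ℂ)
    (l : Fin T₁) (s : ℂ) : ℝ :=
  -2 * ∑ a : Fin 2, ![s.re, s.im] a * ((Hᴴ *ᵥ y) (l, a)).re
    + ∑ a : Fin 2, ∑ b : Fin 2,
        ![s.re, s.im] a * matRe (Hᴴ * H) (l, a) (l, b) * ![s.re, s.im] b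

/-- The error probability `P E`, as a function of the energy `E`, has diversity order `d`. -/
def HasDiversityOrder (P : ℝ → ℝ) (d : ℝ) : Prop :=
  Tendsto (fun E : ℝ => -Real.log (P E) / Real.log E) atTop (𝓝 d)

/-! ### Co-located MIMO -/

/-- The channel gains `h_{jd}` and the noise `z_d` of the co-located system. -/
abbrev CoSpace (N T₂ : ℕ) : Type := (Fin N → ℂ) × (Fin T₂ → ℂ)

/-- All gains and noise samples are independent and `CN(0,1)`. -/
def coMeasure (N T₂ : ℕ) : Measure (CoSpace N T₂) :=
  (Measure.pi fun _ => complexGaussian).prod (Measure.pi fun _ => complexGaussian)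

/-- `√E_t ∑ⱼ h_{jd} Aⱼ`. -/
def coHeq {N T₁ T₂ : ℕ} (A : Fin N → Matrix (Fin T₂) (Fin T₁ × Fin 2) ℂ) (Et : ℝ)
    (hd : Fin N → ℂ) : Matrix (Fin T₂) (Fin T₁ × Fin 2) ℂ :=
  (Real.sqrt Et : ℂ) • ∑ j, hd j • A j

/-- The received vector of the co-located system when `x` is sent. -/
def coReceived {N T₁ T₂ : ℕ} (A : Fin N → Matrix (Fin T₂) (Fin T₁ × Fin 2) ℂ) (Et : ℝ)
    (x : Fin T₁ → ℂ) (ω : CoSpace N T₂) : Fin T₂ → ℂ :=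
  mulRealVec (coHeq A Et ω.1) (realVec x) + ω.2

/-- Pairwise error probability `P(x₁ → x₂)` of maximum likelihood decoding, co-located system. -/
def coPEP {N T₁ T₂ : ℕ} (A : Fin N → Matrix (Fin T₂) (Fin T₁ × Fin 2) ℂ)
    (x₁ x₂ : Fin T₁ → ℂ) (Et : ℝ) : ℝ :=
  (coMeasure N T₂).real
    {ω | euclidMetric (coHeq A Et ω.1) (coReceived A Et x₁ ω) x₂
      ≤ euclidMetric (coHeq A Et ω.1) (coReceived A Et x₁ ω) x₁}

/-- With the signal sets `S` the code has full diversity for co-located MIMO. -/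
def CoFullDiversity {N T₁ T₂ : ℕ} (A : Fin N → Matrix (Fin T₂) (Fin T₁ × Fin 2) ℂ)
    (S : Fin T₁ → Finset ℂ) : Prop :=
  ∀ x₁ ∈ signalSet S, ∀ x₂ ∈ signalSet S, x₁ ≠ x₂ → HasDiversityOrder (coPEP A x₁ x₂) N

/-! ### The partially-coherent relay channel -/

/-- The source-to-relay gains `h_{sj}`, the relay-to-destination gains `h_{jd}`, the
(phase-compensated) relay noise samples `z_j⁽ⁱ⁾` and the destination noise `z_d`. -/
abbrev RelaySpace (N T₁ T₂ : ℕ) : Type :=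
  (Fin N → ℂ) × (Fin N → ℂ) × (Fin N → Fin T₁ → ℂ) × (Fin T₂ → ℂ)

/-- All gains and noise samples are independent and `CN(0,1)`. -/
def relayMeasure (N T₁ T₂ : ℕ) : Measure (RelaySpace N T₁ T₂) :=
  (Measure.pi fun _ => complexGaussian).prod <|
    (Measure.pi fun _ => complexGaussian).prod <|
      (Measure.pi fun _ => Measure.pi fun _ => complexGaussian).prod
        (Measure.pi fun _ => complexGaussian)

/-- Energy per symbol in the broadcast phase, `E₁ = E_t / 2`. -/
def energyOne (Et : ℝ) : ℝ := Et / 2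

/-- Energy per transmission of a symbol in the relay phase, `E₂ = E_t / (2 M)`, where `M` is the
number of transmissions per symbol. -/
def energyTwo (M : ℕ) (Et : ℝ) : ℝ := Et / (2 * M)

/-- The amplification factor `G = √(E₂ / (E₁ + 1))`. -/
def gain (M : ℕ) (Et : ℝ) : ℝ := Real.sqrt (energyTwo M Et / (energyOne Et + 1))

/-- `H_eq^{(pc)} = G √E₁ ∑ⱼ |h_{sj}| h_{jd} Aⱼ`. -/
def relayHeq {N T₁ T₂ : ℕ} (A : Fin N → Matrix (Fin T₂) (Fin T₁ × Fin 2) ℂ) (M : ℕ) (Et : ℝ)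
    (hs hd : Fin N → ℂ) : Matrix (Fin T₂) (Fin T₁ × Fin 2) ℂ :=
  ((gain M Et * Real.sqrt (energyOne Et) : ℝ) : ℂ) • ∑ j, ((‖hs j‖ : ℂ) * hd j) • A j

/-- The total noise `∑ⱼ h_{jd} Aⱼ ẑⱼ + z_d`, with `ẑⱼ` the real vector of the samples `G z_j⁽ⁱ⁾`.
Its covariance matrix given the gains is in general not a multiple of the identity. -/
def totalNoise {N T₁ T₂ : ℕ} (A : Fin N → Matrix (Fin T₂) (Fin T₁ × Fin 2) ℂ) (M : ℕ) (Et : ℝ)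
    (hd : Fin N → ℂ) (z : Fin N → Fin T₁ → ℂ) (zd : Fin T₂ → ℂ) : Fin T₂ → ℂ :=
  (∑ j, hd j • mulRealVec (A j) (realVec fun i => (gain M Et : ℂ) * z j i)) + zd

/-- `H_eq^{(pc)}` at a realization of the system. -/
def relayChannel {N T₁ T₂ : ℕ} (A : Fin N → Matrix (Fin T₂) (Fin T₁ × Fin 2) ℂ) (M : ℕ) (Et : ℝ)
    (ω : RelaySpace N T₁ T₂) : Matrix (Fin T₂) (Fin T₁ × Fin 2) ℂ :=
  relayHeq A M Et ω.1 ω.2.1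

/-- The vector received at the destination when `x` is sent. -/
def relayReceived {N T₁ T₂ : ℕ} (A : Fin N → Matrix (Fin T₂) (Fin T₁ × Fin 2) ℂ) (M : ℕ) (Et : ℝ)
    (x : Fin T₁ → ℂ) (ω : RelaySpace N T₁ T₂) : Fin T₂ → ℂ :=
  mulRealVec (relayChannel A M Et ω) (realVec x) + totalNoise A M Et ω.2.1 ω.2.2.1 ω.2.2.2

/-- Pairwise error probability `P(x₁ → x₂)` in the relay system of the decoder that minimizes
`‖y - H_eq^{(pc)} x‖²`, ignoring the covariance of the total noise. -/
def relayPEP {N T₁ T₂ : ℕ} (A : Fin N → Matrix (Fin T₂) (Fin T₁ × Fin 2) ℂ) (M : ℕ)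
    (x₁ x₂ : Fin T₁ → ℂ) (Et : ℝ) : ℝ :=
  (relayMeasure N T₁ T₂).real
    {ω | euclidMetric (relayChannel A M Et ω) (relayReceived A M Et x₁ ω) x₂
      ≤ euclidMetric (relayChannel A M Et ω) (relayReceived A M Et x₁ ω) x₁}

/-- The probability that, when `x` is sent, the decoder that minimizes the single-symbol metric of
the `l`-th symbol over `S l` alone errs in this symbol (ties count as errors). -/
def relaySymbolError {N T₁ T₂ : ℕ} (A : Fin N → Matrix (Fin T₂) (Fin T₁ × Fin 2) ℂ) (M : ℕ)
    (S : Fin T₁ → Finset ℂ) (x : Fin T₁ → ℂ) (l : Fin T₁) (Et : ℝ) : ℝ :=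
  (relayMeasure N T₁ T₂).real
    {ω | ∃ s ∈ S l, s ≠ x l ∧
      symbolMetric (relayChannel A M Et ω) (relayReceived A M Et x ω) l s
        ≤ symbolMetric (relayChannel A M Et ω) (relayReceived A M Et x ω) l (x l)}

end

end PCRC

namespace PCRC
open scoped ENNReal

/-! Both diversity orders are governed by the vectors `u j = A j (x₁ - x₂)`, called `codeDiff`. If
they satisfied a nontrivial relation, co-located gains within `E^(-1/2)` of a complex line would
keep the received difference bounded. Such gains have probability of order `E^(-(N-1))`, and an
error then has probability bounded below, so the diversity order could not be `N`. Co-located full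
diversity therefore gives linear independence (`linearIndependent_codeDiff`).

In the relay channel, comparing the metrics of `x₁` and `x₂` means comparing `‖v + n‖` with `‖n‖`,
where `v` is the signal difference and `n` the total noise, whatever its covariance. An error forces
`‖v‖ ≤ 2‖n‖`. By linear independence every product `√E |h_{sj}| |h_{jd}|` is then at most a constant
times a polynomial in the gains and noise samples (`exists_relayErrorSet_subset`). Markov's
inequality with the moments `E|h|^(-2s)`, finite for `s < 1`, bounds the probability by a multiple
of `E^(-Ns)` (`exists_relayMeasure_le`). Since `s` may approach 1, this suffices for the order `N`.

Conversely, all `|h_{jd}|` are at most `E^(-1/2)` with probability of order `E^(-N)`, and an error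
is then likely (`exists_le_relayErrorSet`).

The SSD conditions make `Re (Hᴴ H)` block diagonal for every complex combination of the `A j`, in
particular for the relay channel (`matRe_smul_sum_offDiagonal`). The metric then splits, and a
symbol error is a finite union of pairwise errors. -/

/-! ### Lower bounds for the Gaussian mass of small balls. -/

instance : IsProbabilityMeasure complexGaussian := by
  unfold complexGaussian
  exact Measure.isProbabilityMeasure_map (MeasurableEquiv.measurable _).aemeasurable

/-- A Gaussian of variance `1/2` gives an interval of length at most two with bounded centre at
least a fixed multiple of its length. -/
lemma exists_le_gaussianReal_Icc (K : ℝ) : ∃ c : ℝ, 0 < c ∧ ∀ a : ℝ, |a| ≤ K →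
    ∀ r : ℝ, 0 ≤ r → r ≤ 1 →
      ENNReal.ofReal (c * r) ≤ gaussianReal 0 (1 / 2) (Set.Icc (a - r) (a + r)) := by
  -- The interval has length `2r` and lies in `[-(K+1), K+1]`, where the density is smallest at the
  -- endpoints.
  refine ⟨2 * gaussianPDFReal 0 (1 / 2) (K + 1),
    mul_pos two_pos (gaussianPDFReal_pos _ _ _ (by simp)), fun a ha r hr hr1 => ?_⟩
  rw [gaussianReal_apply _ (by simp)]
  calc ENNReal.ofReal (2 * gaussianPDFReal 0 (1 / 2) (K + 1) * r)
      = ∫⁻ _ in Set.Icc (a - r) (a + r), gaussianPDF 0 (1 / 2) (K + 1) := by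
        rw [setLIntegral_const, Real.volume_Icc, gaussianPDF, ← ENNReal.ofReal_mul
          (gaussianPDFReal_nonneg _ _ _)]
        congr 1; ring
    _ ≤ _ := by
        refine setLIntegral_mono (measurable_gaussianPDF _ _) fun x hx => ?_
        refine ENNReal.ofReal_le_ofReal ?_
        simp only [gaussianPDFReal, sub_zero]
        gcongr _ * Real.exp (-?_ / _)
        rw [sq_le_sq]
        refine (abs_le.2 ?_).trans (le_abs_self _)
        have := abs_le.1 ha
        constructor <;> linarith [hx.1, hx.2]

/-- The complex Gaussian law gives a small disc with bounded centre at least a fixed multiple of its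
area. -/
lemma exists_le_complexGaussian_closedBall (K : ℝ) : ∃ c : ℝ, 0 < c ∧ ∀ a : ℂ, ‖a‖ ≤ K →
    ∀ r : ℝ, 0 ≤ r → r ≤ 1 →
      ENNReal.ofReal (c * r ^ 2) ≤ complexGaussian (Metric.closedBall a r) := by
  obtain ⟨c, hc, h⟩ := exists_le_gaussianReal_Icc K
  -- The disc contains the concentric square of half-side `r / 2`, each side of which contributes a
  -- factor `c * (r / 2)`.
  refine ⟨c ^ 2 / 4, by positivity, fun a ha r hr hr1 => ?_⟩
  rw [complexGaussian, MeasurableEquiv.map_apply]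
  calc ENNReal.ofReal (c ^ 2 / 4 * r ^ 2)
      = ENNReal.ofReal (c * (r / 2)) * ENNReal.ofReal (c * (r / 2)) := by
        rw [← ENNReal.ofReal_mul (by positivity)]; congr 1; ring
    _ ≤ gaussianReal 0 (1 / 2) (Set.Icc (a.re - r / 2) (a.re + r / 2))
          * gaussianReal 0 (1 / 2) (Set.Icc (a.im - r / 2) (a.im + r / 2)) :=
        mul_le_mul' (h _ ((Complex.abs_re_le_norm a).trans ha) _ (by linarith) (by linarith))
          (h _ ((Complex.abs_im_le_norm a).trans ha) _ (by linarith) (by linarith))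
    _ ≤ _ := by
        rw [← Measure.prod_prod]
        refine measure_mono fun p hp => ?_
        obtain ⟨h1, h2⟩ := hp
        simp only [Set.mem_preimage, Metric.mem_closedBall, dist_eq_norm]
        refine (Complex.norm_le_abs_re_add_abs_im _).trans ?_
        have e1 : |p.1 - a.re| ≤ r / 2 := abs_le.2 ⟨by linarith [h1.1], by linarith [h1.2]⟩
        have e2 : |p.2 - a.im| ≤ r / 2 := abs_le.2 ⟨by linarith [h2.1], by linarith [h2.2]⟩
        simp only [Complex.measurableEquivRealProd_symm_apply, Complex.sub_re, Complex.sub_im]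
        linarith

/-! ### Weighted negative moments of Gaussians. -/

/-- For negative `x` the real power `x ^ s` is not `|x| ^ s`, so the integrand is dominated by the
function with `x ^ s` plus its reflection, one of which has the right value. -/
lemma integrable_abs_rpow_mul_exp {b s : ℝ} (hb : 0 < b) (hs : -1 < s) :
    Integrable fun x : ℝ => |x| ^ s * Real.exp (-b * x ^ 2) := by
  have h := integrable_rpow_mul_exp_neg_mul_sq hb hs
  refine (h.norm.add h.comp_neg.norm).mono' (by fun_prop) (ae_of_all _ fun x => ?_)
  rw [Real.norm_of_nonneg (by positivity)]
  simp only [Pi.add_apply, norm_mul, neg_sq, Real.norm_eq_abs, Real.abs_exp]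
  rcases le_total 0 x with hx | hx
  · rw [abs_of_nonneg hx]
    exact (mul_le_mul_of_nonneg_right (le_abs_self _) (by positivity)).trans
      (le_add_of_nonneg_right (by positivity))
  · rw [abs_of_nonpos hx]
    exact (mul_le_mul_of_nonneg_right (le_abs_self _) (by positivity)).trans
      (le_add_of_nonneg_left (by positivity))

/-- Half of the Gaussian exponent absorbs any polynomial: `t ^ p / p! ≤ exp t` at `t = 1 + |x| ≤ 3/2
+ x²/2`. -/
lemma one_add_abs_pow_le (p : ℕ) (x : ℝ) :
    (1 + |x|) ^ p ≤ p.factorial * Real.exp (3 / 2) * Real.exp (x ^ 2 / 2) := by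
  have h := Real.pow_div_factorial_le_exp (1 + |x|) (by positivity) p
  rw [div_le_iff₀ (by positivity)] at h
  rw [mul_assoc, ← Real.exp_add, mul_comm]
  refine h.trans (mul_le_mul_of_nonneg_right (Real.exp_le_exp.2 ?_) (by positivity))
  nlinarith [sq_abs x, sq_nonneg (|x| - 1)]

/-- Moments of a Gaussian weighted by a negative power larger than `-1` are finite. -/
lemma lintegral_gaussianReal_rpow_lt_top {s : ℝ} (hs1 : s < 1) (p : ℕ) :
    ∫⁻ x, ‖x‖ₑ ^ (-s) * (1 + ‖x‖ₑ) ^ p ∂(gaussianReal 0 (1 / 2)) < ∞ := by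
  rw [gaussianReal_of_var_ne_zero _ (by simp), lintegral_withDensity_eq_lintegral_mul _
    (measurable_gaussianPDF _ _) (by fun_prop)]
  set C : ℝ := (√Real.pi)⁻¹ * (p.factorial * Real.exp (3 / 2))
  have hi := (integrable_abs_rpow_mul_exp (b := 1 / 2) (s := -s) (by norm_num)
    (by linarith)).const_mul C
  refine lt_of_le_of_lt (lintegral_mono_ae ?_) hi.2
  -- At `0` a negative power is `∞` in `ℝ≥0∞` but `0` in `ℝ`.
  have h0 : ∀ᵐ x : ℝ, x ≠ 0 := by simp [ae_iff]
  filter_upwards [h0] with x hx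
  have e1 : ‖x‖ₑ = ENNReal.ofReal |x| := by rw [Real.enorm_eq_ofReal_abs]
  have e2 : 1 + ‖x‖ₑ = ENNReal.ofReal (1 + |x|) := by
    rw [ENNReal.ofReal_add zero_le_one (abs_nonneg _), e1, ENNReal.ofReal_one]
  rw [Pi.mul_apply, e2, e1, ENNReal.ofReal_rpow_of_pos (abs_pos.2 hx), ← ENNReal.ofReal_pow
    (by positivity), gaussianPDF, ← ENNReal.ofReal_mul (by positivity),
    ← ENNReal.ofReal_mul (gaussianPDFReal_nonneg _ _ _), Real.enorm_eq_ofReal_abs]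
  refine ENNReal.ofReal_le_ofReal (le_trans ?_ (le_abs_self _))
  have e3 : gaussianPDFReal 0 (1 / 2) x = (√Real.pi)⁻¹ * Real.exp (-x ^ 2) := by
    simp [gaussianPDFReal]
    field_simp
  have e4 : Real.exp (-(1 / 2) * x ^ 2) = Real.exp (-x ^ 2) * Real.exp (x ^ 2 / 2) := by
    rw [← Real.exp_add]; congr 1; ring
  rw [e3, e4]
  have := mul_le_mul_of_nonneg_left (one_add_abs_pow_le p x)
    (show 0 ≤ (√Real.pi)⁻¹ * Real.exp (-x ^ 2) * |x| ^ (-s) by positivity)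
  calc _ = _ := by rw [← mul_assoc]
    _ ≤ _ := this
    _ = _ := by simp only [C]; ring

lemma rpow_neg_le_rpow_neg {s : ℝ} (hs : 0 ≤ s) {x y : ℝ≥0∞} (h : x ≤ y) :
    y ^ (-s) ≤ x ^ (-s) := by
  rw [ENNReal.rpow_neg, ENNReal.rpow_neg]
  exact ENNReal.inv_le_inv.2 (ENNReal.rpow_le_rpow h hs)

/-- Moments of a complex Gaussian weighted by a negative power larger than `-2` are finite. -/
lemma lintegral_complexGaussian_rpow_lt_top {s : ℝ} (hs : 0 ≤ s) (hs1 : s < 1) (p : ℕ) :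
    ∫⁻ z, ‖z‖ₑ ^ (-(2 * s)) * (1 + ‖z‖ₑ) ^ p ∂complexGaussian < ∞ := by
  rw [complexGaussian, lintegral_map (by fun_prop) (MeasurableEquiv.measurable _)]
  set F : ℝ → ℝ≥0∞ := fun x => ‖x‖ₑ ^ (-s) * (1 + ‖x‖ₑ) ^ p
  have hF : ∫⁻ x, F x ∂(gaussianReal 0 (1 / 2)) < ∞ := lintegral_gaussianReal_rpow_lt_top hs1 p
  have hm : Measurable F := by fun_prop
  calc _ ≤ ∫⁻ q, F q.1 * F q.2 ∂((gaussianReal 0 (1 / 2)).prod (gaussianReal 0 (1 / 2))) := by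
        refine lintegral_mono fun q => ?_
        set z : ℂ := Complex.measurableEquivRealProd.symm q
        have hr : q.1 = z.re := by simp [z]
        have hi : q.2 = z.im := by simp [z]
        have h1 : ‖z‖ₑ ≤ ‖z.re‖ₑ + ‖z.im‖ₑ := by
          simp only [← ofReal_norm]
          rw [← ENNReal.ofReal_add (by positivity) (by positivity)]
          exact ENNReal.ofReal_le_ofReal (Complex.norm_le_abs_re_add_abs_im z)
        have h2 : ‖z.re‖ₑ ≤ ‖z‖ₑ := by
          simp only [← ofReal_norm]
          exact ENNReal.ofReal_le_ofReal (Complex.abs_re_le_norm z)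
        have h3 : ‖z.im‖ₑ ≤ ‖z‖ₑ := by
          simp only [← ofReal_norm]
          exact ENNReal.ofReal_le_ofReal (Complex.abs_im_le_norm z)
        simp only [F, hr, hi]
        -- Since `|z|` dominates both coordinates, the exponent `2s < 2` is shared evenly between
        -- them, and each one-dimensional exponent `s < 1` is integrable.
        calc ‖z‖ₑ ^ (-(2 * s)) * (1 + ‖z‖ₑ) ^ p
            ≤ (‖z.re‖ₑ ^ (-s) * ‖z.im‖ₑ ^ (-s)) * ((1 + ‖z.re‖ₑ) * (1 + ‖z.im‖ₑ)) ^ p := by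
              refine mul_le_mul' ?_ (pow_le_pow_left' ?_ p)
              · rw [show -(2 * s) = -s * (2 : ℕ) by push_cast; ring, ENNReal.rpow_mul,
                  ENNReal.rpow_natCast, sq]
                exact mul_le_mul' (rpow_neg_le_rpow_neg hs h2)
                  (rpow_neg_le_rpow_neg hs h3)
              · calc 1 + ‖z‖ₑ ≤ 1 + (‖z.re‖ₑ + ‖z.im‖ₑ) := by gcongr
                  _ ≤ 1 + (‖z.re‖ₑ + ‖z.im‖ₑ) + ‖z.re‖ₑ * ‖z.im‖ₑ := le_self_add
                  _ = _ := by ring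
          _ = _ := by rw [mul_pow]; ring
    _ = (∫⁻ x, F x ∂(gaussianReal 0 (1 / 2))) * ∫⁻ x, F x ∂(gaussianReal 0 (1 / 2)) :=
        lintegral_prod_mul hm.aemeasurable hm.aemeasurable
    _ < ∞ := ENNReal.mul_lt_top hF hF

/-! ### Integrals and lower bounds on product spaces. -/

lemma lintegral_pi_prod {ι α : Type*} [Fintype ι] [MeasurableSpace α] (μ : Measure α)
    [IsProbabilityMeasure μ] {f : α → ℝ≥0∞} (hf : Measurable f) :
    ∫⁻ x : ι → α, ∏ i, f (x i) ∂(Measure.pi fun _ => μ) = (∫⁻ x, f x ∂μ) ^ Fintype.card ι := by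
  have hi : iIndepFun (fun (i : ι) (x : ι → α) => f (x i)) (Measure.pi fun _ => μ) :=
    iIndepFun_pi (X := fun _ => f) fun _ => hf.aemeasurable
  rw [lintegral_prod_eq_prod_lintegral_of_indepFun _ _ hi fun i => by fun_prop]
  rw [Finset.prod_congr rfl fun i _ =>
    (measurePreserving_eval (fun _ : ι => μ) i).lintegral_comp hf]
  simp

/-- A lower bound for a product measure from a lower bound for the sections. -/
lemma mul_le_prod_apply {α β : Type*} [MeasurableSpace α] [MeasurableSpace β] {μ : Measure α}
    {ν : Measure β} [SFinite ν] {s : Set (α × β)} (hs : MeasurableSet s) {t : Set α} {c : ℝ≥0∞}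
    (h : ∀ x ∈ t, c ≤ ν (Prod.mk x ⁻¹' s)) : μ t * c ≤ μ.prod ν s := by
  rw [Measure.prod_apply hs, mul_comm]
  refine le_trans ?_ (mul_meas_ge_le_lintegral₀ (measurable_measure_prodMk_left hs).aemeasurable c)
  gcongr
  exact h

/-! ### Diversity order -/

lemma eventually_div_log (C : ℝ) {δ : ℝ} (hδ : 0 < δ) : ∀ᶠ E : ℝ in atTop, C / Real.log E < δ :=
  (Real.tendsto_log_atTop.const_div_atTop C).eventually_lt_const hδ

lemma eventually_neg_log_div_lt {P : ℝ → ℝ} {d c δ : ℝ} (hδ : 0 < δ) (hc : 0 < c)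
    (h : ∀ᶠ E in atTop, c * E ^ (-d) ≤ P E) :
    ∀ᶠ E in atTop, -Real.log (P E) / Real.log E < d + δ := by
  filter_upwards [h, eventually_div_log (-Real.log c) hδ, eventually_gt_atTop 1] with E hE hlt h1
  have hl : 0 < Real.log E := Real.log_pos h1
  have hp : 0 < c * E ^ (-d) := by positivity
  have := Real.log_le_log hp hE
  rw [Real.log_mul hc.ne' (by positivity), Real.log_rpow (by linarith)] at this
  rw [div_lt_iff₀ hl] at hlt ⊢
  linarith

lemma eventually_lt_neg_log_div {P : ℝ → ℝ} {d C δ : ℝ} (hδ : 0 < δ) (hC : 0 < C)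
    (hP : ∀ᶠ E in atTop, 0 < P E) (h : ∀ᶠ E in atTop, P E ≤ C * E ^ (-d)) :
    ∀ᶠ E in atTop, d - δ < -Real.log (P E) / Real.log E := by
  filter_upwards [h, hP, eventually_div_log (Real.log C) hδ, eventually_gt_atTop 1] with E hE hp hlt h1
  have hl : 0 < Real.log E := Real.log_pos h1
  have := Real.log_le_log hp hE
  rw [Real.log_mul hC.ne' (by positivity), Real.log_rpow (by linarith)] at this
  rw [lt_div_iff₀ hl]
  rw [div_lt_iff₀ hl] at hlt
  linarith

/-- The limit cannot see factors smaller than every power of `E`, so upper bounds for all `d' < d`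
suffice. The exponent `d` itself would need `E|h|^(-2)`, which is infinite. -/
lemma hasDiversityOrder_of_bounds {P : ℝ → ℝ} {d : ℝ}
    (hub : ∀ d' < d, ∃ C : ℝ, 0 < C ∧ ∀ᶠ E in atTop, P E ≤ C * E ^ (-d'))
    (hlb : ∃ c : ℝ, 0 < c ∧ ∀ᶠ E in atTop, c * E ^ (-d) ≤ P E) : HasDiversityOrder P d := by
  obtain ⟨c, hc, hlb⟩ := hlb
  refine tendsto_order.2 ⟨fun a ha => ?_, fun a ha => ?_⟩
  · obtain ⟨C, hC, h⟩ := hub ((a + d) / 2) (by linarith)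
    have hP : ∀ᶠ E in atTop, 0 < P E := by
      filter_upwards [hlb, eventually_gt_atTop 0] with E hE h0
      exact lt_of_lt_of_le (by positivity) hE
    filter_upwards [eventually_lt_neg_log_div (δ := (d - a) / 2) (by linarith) hC hP h] with E hE
    linarith
  · filter_upwards [eventually_neg_log_div_lt (δ := a - d) (by linarith) hc hlb] with E hE
    linarith

lemma not_hasDiversityOrder_of_le {P : ℝ → ℝ} {d d' c : ℝ} (hd : d' < d) (hc : 0 < c)
    (h : ∀ᶠ E in atTop, c * E ^ (-d') ≤ P E) : ¬ HasDiversityOrder P d := by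
  intro hP
  obtain ⟨E, h1, h2⟩ := ((hP.eventually_const_lt (show (d + d') / 2 < d by linarith)).and
    (eventually_neg_log_div_lt (δ := (d - d') / 2) (by linarith) hc h)).exists
  linarith

/-! ### Probabilities of error events from above -/

/-- Pointwise form of Markov's inequality with a negative moment. As `w ≥ 1`, the power `w ^ (2s)`
may be raised to `w ^ 2`, whose exponent is natural. -/
lemma one_le_rpow_mul {s : ℝ} (hs : 0 ≤ s) (hs1 : s ≤ 1) {k x y w : ℝ≥0∞} (hk : k ≠ ∞)
    (hx : x ≠ ∞) (hy : y ≠ ∞) (hw1 : 1 ≤ w) (hw : w ≠ ∞) (h : k * x * y ≤ w) :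
    1 ≤ k ^ (-(2 * s)) * x ^ (-(2 * s)) * y ^ (-(2 * s)) * w ^ 2 := by
  rw [← ENNReal.mul_rpow_of_ne_top hk hx, ← ENNReal.mul_rpow_of_ne_top (ENNReal.mul_ne_top hk hx) hy]
  have hw0 : w ≠ 0 := (zero_lt_one.trans_le hw1).ne'
  calc (1 : ℝ≥0∞) = w ^ (-(2 * s)) * w ^ (2 * s) := by
        rw [← ENNReal.rpow_add _ _ hw0 hw]; simp
    _ ≤ (k * x * y) ^ (-(2 * s)) * w ^ (2 : ℝ) := by
        gcongr ?_ * ?_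
        · exact rpow_neg_le_rpow_neg (by linarith) h
        · exact ENNReal.rpow_le_rpow_of_exponent_le hw1 (by linarith)
    _ = _ := by rw [ENNReal.rpow_two]

/-- A common bound for all gains and noise samples of the second hop. -/
noncomputable def noiseBound {N T₁ T₂ : ℕ} (ω : RelaySpace N T₁ T₂) : ℝ :=
  (∏ j, (1 + ‖ω.2.1 j‖)) * ((∏ j, ∏ i, (1 + ‖ω.2.2.1 j i‖)) * ∏ t, (1 + ‖ω.2.2.2 t‖))

lemma le_prod_of_one_le {ι : Type*} [Fintype ι] (f : ι → ℝ) (hf : ∀ i, 1 ≤ f i) (i : ι) :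
    f i ≤ ∏ i, f i := by
  classical
  rw [← Finset.mul_prod_erase _ _ (Finset.mem_univ i)]
  exact le_mul_of_one_le_right (zero_le_one.trans (hf i))
    (Finset.one_le_prod fun j _ => hf j)

lemma one_le_prod_one_add_norm {ι : Type*} [Fintype ι] (f : ι → ℂ) : 1 ≤ ∏ i, (1 + ‖f i‖) :=
  Finset.one_le_prod fun j _ => by simp

lemma one_le_prod_prod {ι κ : Type*} [Fintype ι] [Fintype κ] (f : ι → κ → ℂ) :
    1 ≤ ∏ i, ∏ j, (1 + ‖f i j‖) :=
  Finset.one_le_prod fun _ _ => one_le_prod_one_add_norm _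

lemma norm_le_prod {ι : Type*} [Fintype ι] (f : ι → ℂ) (i : ι) : ‖f i‖ ≤ ∏ i, (1 + ‖f i‖) :=
  (by simp : ‖f i‖ ≤ 1 + ‖f i‖).trans
    (le_prod_of_one_le (fun i => 1 + ‖f i‖) (fun i => by simp) i)

lemma one_le_noiseBound {N T₁ T₂ : ℕ} (ω : RelaySpace N T₁ T₂) : 1 ≤ noiseBound ω :=
  one_le_mul_of_one_le_of_one_le (one_le_prod_one_add_norm _)
    (one_le_mul_of_one_le_of_one_le (one_le_prod_prod _) (one_le_prod_one_add_norm _))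

lemma norm_mul_norm_le_noiseBound {N T₁ T₂ : ℕ} (ω : RelaySpace N T₁ T₂) (j : Fin N)
    (i : Fin T₁) : ‖ω.2.1 j‖ * ‖ω.2.2.1 j i‖ ≤ noiseBound ω := by
  have h : ‖ω.2.2.1 j i‖ ≤ ∏ j, ∏ i, (1 + ‖ω.2.2.1 j i‖) :=
    (norm_le_prod (ω.2.2.1 j) i).trans (le_prod_of_one_le (fun j => ∏ i, (1 + ‖ω.2.2.1 j i‖))
      (fun j => one_le_prod_one_add_norm _) j)
  refine mul_le_mul (norm_le_prod _ j) (h.trans ?_) (norm_nonneg _) (by positivity)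
  exact le_mul_of_one_le_right (by positivity) (one_le_prod_one_add_norm _)

lemma norm_le_noiseBound {N T₁ T₂ : ℕ} (ω : RelaySpace N T₁ T₂) (t : Fin T₂) :
    ‖ω.2.2.2 t‖ ≤ noiseBound ω := by
  refine (norm_le_prod _ t).trans ?_
  rw [noiseBound, ← mul_assoc]
  exact le_mul_of_one_le_left (by positivity)
    (one_le_mul_of_one_le_of_one_le (one_le_prod_one_add_norm _) (one_le_prod_prod _))

lemma ofReal_prod_one_add_norm {ι : Type*} [Fintype ι] (f : ι → ℂ) :
    ENNReal.ofReal (∏ i, (1 + ‖f i‖)) = ∏ i, (1 + ‖f i‖ₑ) := by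
  rw [ENNReal.ofReal_prod_of_nonneg fun i _ => by positivity]
  refine Finset.prod_congr rfl fun i _ => ?_
  rw [ENNReal.ofReal_add zero_le_one (norm_nonneg _), ofReal_norm, ENNReal.ofReal_one]

/-- A product, unlike a maximum, has powers that integrate coordinate by coordinate under
independence. -/
lemma ofReal_noiseBound {N T₁ T₂ : ℕ} (ω : RelaySpace N T₁ T₂) :
    ENNReal.ofReal (noiseBound ω) = (∏ j, (1 + ‖ω.2.1 j‖ₑ)) *
      ((∏ j, ∏ i, (1 + ‖ω.2.2.1 j i‖ₑ)) * ∏ t, (1 + ‖ω.2.2.2 t‖ₑ)) := by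
  rw [noiseBound, ENNReal.ofReal_mul (by positivity), ENNReal.ofReal_mul (by positivity),
    ofReal_prod_one_add_norm, ofReal_prod_one_add_norm,
    ENNReal.ofReal_prod_of_nonneg fun i _ => by positivity]
  simp only [ofReal_prod_one_add_norm]

lemma lintegral_relayMeasure_mul {N T₁ T₂ : ℕ} {f g : (Fin N → ℂ) → ℝ≥0∞}
    {h : (Fin N → Fin T₁ → ℂ) → ℝ≥0∞} {l : (Fin T₂ → ℂ) → ℝ≥0∞} (hf : Measurable f)
    (hg : Measurable g) (hh : Measurable h) (hl : Measurable l) :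
    ∫⁻ ω, f ω.1 * (g ω.2.1 * (h ω.2.2.1 * l ω.2.2.2)) ∂(relayMeasure N T₁ T₂)
      = (∫⁻ x, f x ∂(Measure.pi fun _ => complexGaussian)) *
        ((∫⁻ x, g x ∂(Measure.pi fun _ => complexGaussian)) *
          ((∫⁻ x, h x ∂(Measure.pi fun _ => Measure.pi fun _ => complexGaussian)) *
            ∫⁻ x, l x ∂(Measure.pi fun _ => complexGaussian))) := by
  rw [relayMeasure,
    lintegral_prod_mul (g := fun q : (Fin N → ℂ) × (Fin N → Fin T₁ → ℂ) × (Fin T₂ → ℂ) =>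
      g q.1 * (h q.2.1 * l q.2.2)) hf.aemeasurable (Measurable.aemeasurable (by fun_prop)),
    lintegral_prod_mul (g := fun q : (Fin N → Fin T₁ → ℂ) × (Fin T₂ → ℂ) => h q.1 * l q.2)
      hg.aemeasurable (Measurable.aemeasurable (by fun_prop)),
    lintegral_prod_mul hh.aemeasurable hl.aemeasurable]

lemma measurable_prod_eval {ι α : Type*} [Fintype ι] [MeasurableSpace α] {f : α → ℝ≥0∞}
    (hf : Measurable f) : Measurable fun x : ι → α => ∏ i, f (x i) :=
  Finset.measurable_prod _ fun i _ => hf.comp (measurable_pi_apply i)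

/-- The probability that all products of gains are small compared with the noise. -/
lemma exists_relayMeasure_le (N T₁ T₂ : ℕ) {s : ℝ} (hs : 0 ≤ s) (hs1 : s < 1) :
    ∃ C : ℝ≥0∞, C ≠ ∞ ∧ ∀ k : ℝ, 0 < k →
      relayMeasure N T₁ T₂ {ω | ∀ j, k * ‖ω.1 j‖ * ‖ω.2.1 j‖ ≤ noiseBound ω}
        ≤ (ENNReal.ofReal k ^ (-(2 * s))) ^ N * C := by
  set f : ℂ → ℝ≥0∞ := fun z => ‖z‖ₑ ^ (-(2 * s))
  -- The exponent `2 * N` arises because the `N` inequalities, each with a factor `w ^ 2`, are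
  -- multiplied together.
  set g : ℂ → ℝ≥0∞ := fun z => ‖z‖ₑ ^ (-(2 * s)) * (1 + ‖z‖ₑ) ^ (2 * N)
  set h : ℂ → ℝ≥0∞ := fun z => (1 + ‖z‖ₑ) ^ (2 * N)
  have hf : Measurable f := by fun_prop
  have hg : Measurable g := by fun_prop
  have hh : Measurable h := by fun_prop
  have If : ∫⁻ z, f z ∂complexGaussian ≠ ∞ := by
    simpa using (lintegral_complexGaussian_rpow_lt_top hs hs1 0).ne
  have Ig : ∫⁻ z, g z ∂complexGaussian ≠ ∞ :=
    (lintegral_complexGaussian_rpow_lt_top hs hs1 (2 * N)).ne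
  have Ih : ∫⁻ z, h z ∂complexGaussian ≠ ∞ := by
    simpa using (lintegral_complexGaussian_rpow_lt_top le_rfl zero_lt_one (2 * N)).ne
  refine ⟨(∫⁻ z, f z ∂complexGaussian) ^ N * ((∫⁻ z, g z ∂complexGaussian) ^ N *
    (((∫⁻ z, h z ∂complexGaussian) ^ T₁) ^ N * (∫⁻ z, h z ∂complexGaussian) ^ T₂)),
    by finiteness, fun k hk => ?_⟩
  set F : RelaySpace N T₁ T₂ → ℝ≥0∞ := fun ω => (ENNReal.ofReal k ^ (-(2 * s))) ^ N *
    ((∏ j, f (ω.1 j)) * ((∏ j, g (ω.2.1 j)) *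
      ((∏ j, ∏ i, h (ω.2.2.1 j i)) * ∏ t, h (ω.2.2.2 t))))
  have mf := measurable_prod_eval (ι := Fin N) hf
  have mg := measurable_prod_eval (ι := Fin N) hg
  have mh' := measurable_prod_eval (ι := Fin T₁) hh
  have mh := measurable_prod_eval (ι := Fin N) mh'
  have ml := measurable_prod_eval (ι := Fin T₂) hh
  have hFm : Measurable F := by
    refine Measurable.const_mul ?_ _
    exact (mf.comp measurable_fst).mul ((mg.comp (by fun_prop)).mul
      ((mh.comp (by fun_prop)).mul (ml.comp (by fun_prop))))
  have hint : ∫⁻ ω, F ω ∂(relayMeasure N T₁ T₂) = (ENNReal.ofReal k ^ (-(2 * s))) ^ N *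
      ((∫⁻ z, f z ∂complexGaussian) ^ N * ((∫⁻ z, g z ∂complexGaussian) ^ N *
    (((∫⁻ z, h z ∂complexGaussian) ^ T₁) ^ N * (∫⁻ z, h z ∂complexGaussian) ^ T₂))) := by
    simp only [F]
    rw [lintegral_const_mul' _ _ (by finiteness), lintegral_relayMeasure_mul mf mg mh ml,
      lintegral_pi_prod _ hf, lintegral_pi_prod _ hg, lintegral_pi_prod _ hh,
      lintegral_pi_prod _ mh', lintegral_pi_prod _ hh]
    simp only [Fintype.card_fin]
  rw [← hint]
  refine le_trans (measure_mono fun ω hω => ?_)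
    ((mul_meas_ge_le_lintegral hFm 1).trans' (by rw [one_mul]))
  simp only [Set.mem_ofPred_eq] at hω ⊢
  set w := ENNReal.ofReal (noiseBound ω) with hw
  have hterm : ∀ j, 1 ≤ ENNReal.ofReal k ^ (-(2 * s)) * f (ω.1 j) * ‖ω.2.1 j‖ₑ ^ (-(2 * s))
      * w ^ 2 := by
    intro j
    refine one_le_rpow_mul hs hs1.le ENNReal.ofReal_ne_top enorm_ne_top enorm_ne_top ?_
      ENNReal.ofReal_ne_top ?_
    · rw [hw, ← ENNReal.ofReal_one]
      exact ENNReal.ofReal_le_ofReal (one_le_noiseBound ω)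
    · rw [← ofReal_norm, ← ofReal_norm, ← ENNReal.ofReal_mul hk.le,
        ← ENNReal.ofReal_mul (by positivity)]
      exact ENNReal.ofReal_le_ofReal (hω j)
  have hprod := Finset.one_le_prod' (s := Finset.univ) fun j _ => hterm j
  refine hprod.trans (le_of_eq ?_)
  simp only [F, g, h, Finset.prod_mul_distrib, Finset.prod_const, Finset.card_univ,
    Fintype.card_fin, Finset.prod_pow]
  rw [hw, ofReal_noiseBound, ← pow_mul, mul_pow, mul_pow]
  ring

/-! ### Error events -/

/-- From `‖v‖² ≤ 2‖v + n‖² + 2‖n‖² ≤ 4‖n‖² ≤ 4TB²`; the factor `T + 1` avoids a square root. -/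
lemma norm_le_of_sum_norm_add_sq_le {T : ℕ} {v n : Fin T → ℂ} {B : ℝ} (hB : 0 ≤ B)
    (hn : ∀ t, ‖n t‖ ≤ B) (h : ∑ t, ‖v t + n t‖ ^ 2 ≤ ∑ t, ‖n t‖ ^ 2) (t : Fin T) :
    ‖v t‖ ≤ 2 * (T + 1) * B := by
  have h1 : ∑ t, ‖v t‖ ^ 2 ≤ ∑ t, (2 * ‖v t + n t‖ ^ 2 + 2 * ‖n t‖ ^ 2) := by
    refine Finset.sum_le_sum fun t _ => ?_
    have : ‖v t‖ ≤ ‖v t + n t‖ + ‖n t‖ := by simpa using norm_sub_le (v t + n t) (n t)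
    nlinarith [norm_nonneg (v t), sq_nonneg (‖v t + n t‖ - ‖n t‖)]
  have h2 : ∑ t, ‖n t‖ ^ 2 ≤ T * B ^ 2 := by
    calc ∑ t, ‖n t‖ ^ 2 ≤ ∑ _t : Fin T, B ^ 2 :=
          Finset.sum_le_sum fun t _ => pow_le_pow_left₀ (norm_nonneg _) (hn t) 2
      _ = _ := by simp
  have h3 : ‖v t‖ ^ 2 ≤ ∑ t, ‖v t‖ ^ 2 :=
    Finset.single_le_sum (f := fun t => ‖v t‖ ^ 2) (fun t _ => by positivity) (Finset.mem_univ t)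
  rw [Finset.sum_add_distrib, ← Finset.mul_sum, ← Finset.mul_sum] at h1
  refine abs_le_of_sq_le_sq' ?_ (by positivity) |>.2
  have hT : (0 : ℝ) ≤ T := by positivity
  nlinarith [mul_nonneg hT (sq_nonneg B), mul_nonneg (mul_nonneg hT hT) (sq_nonneg B), sq_nonneg B]

/-- Around a suitable point of bounded norm, adding a given bounded `v` does not increase norms. -/
lemma exists_forall_norm_add_le {C : ℝ} (hC : 0 ≤ C) {v : ℂ} (hv : ‖v‖ ≤ C) :
    ∃ a : ℂ, ‖a‖ ≤ C + 2 ∧ ∀ n : ℂ, ‖n - a‖ ≤ 2 → ‖v + n‖ ≤ ‖n‖ := by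
  rcases eq_or_ne v 0 with rfl | hv0
  · exact ⟨0, by simpa using by linarith, fun n _ => by simp⟩
  have hvp : 0 < ‖v‖ := norm_pos_iff.2 hv0
  -- The point is opposite to `v` at distance `C / 2 + 2`. Within distance 2 of it, `⟪v, n⟫ ≤ -(C /
  -- 2)‖v‖ ≤ -‖v‖² / 2`.
  refine ⟨(-((C / 2 + 2) / ‖v‖) : ℝ) • v, ?_, fun n hn => ?_⟩
  · rw [norm_smul, Real.norm_eq_abs, abs_neg, abs_of_nonneg (by positivity),
      div_mul_cancel₀ _ hvp.ne']
    linarith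
  · refine abs_le_of_sq_le_sq' ?_ (norm_nonneg _) |>.2
    rw [norm_add_sq_real]
    set e := n - (-((C / 2 + 2) / ‖v‖) : ℝ) • v with he
    have hne : n = (-((C / 2 + 2) / ‖v‖) : ℝ) • v + e := by rw [he]; ring
    have h1 : inner ℝ v n = -((C / 2 + 2) * ‖v‖) + inner ℝ v e := by
      conv_lhs => rw [hne]
      rw [inner_add_right, inner_smul_right, real_inner_self_eq_norm_sq]
      congr 1
      field_simp
    have h2 : inner ℝ v e ≤ ‖v‖ * 2 :=
      (real_inner_le_norm v e).trans (mul_le_mul_of_nonneg_left hn hvp.le)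
    nlinarith

lemma ofReal_pow_card_le_pi {ι : Type*} [Fintype ι] {c : ℝ} (hc : 0 ≤ c) {s : ι → Set ℂ}
    (h : ∀ i, ENNReal.ofReal c ≤ complexGaussian (s i)) :
    ENNReal.ofReal (c ^ Fintype.card ι) ≤
      (Measure.pi fun _ : ι => complexGaussian) (Set.univ.pi s) := by
  rw [Measure.pi_pi, ENNReal.ofReal_pow hc]
  simpa using Finset.prod_le_prod' (s := Finset.univ) fun i _ => h i

/-- Given a bounded signal difference and a bounded part of the noise, an error has a probability
bounded away from zero. -/
lemma exists_le_pi_error (T : ℕ) {C : ℝ} (hC : 0 ≤ C) : ∃ c : ℝ, 0 < c ∧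
    ∀ v w : Fin T → ℂ, (∀ t, ‖v t‖ ≤ C) → (∀ t, ‖w t‖ ≤ 1) →
      ENNReal.ofReal c ≤ (Measure.pi fun _ => complexGaussian)
        {z : Fin T → ℂ | ∑ t, ‖v t + (w t + z t)‖ ^ 2 ≤ ∑ t, ‖w t + z t‖ ^ 2} := by
  obtain ⟨c, hc, hball⟩ := exists_le_complexGaussian_closedBall (C + 2)
  refine ⟨c ^ T, by positivity, fun v w hv hw => ?_⟩
  choose a ha hva using fun t => exists_forall_norm_add_le hC (hv t)
  -- Radius 1 for `z` leaves room for `w`, of norm at most 1, in the disc of radius 2.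
  have := ofReal_pow_card_le_pi hc.le fun t => by
    simpa using hball (a t) (ha t) 1 zero_le_one le_rfl
  rw [Fintype.card_fin] at this
  refine this.trans (measure_mono fun z hz => ?_)
  refine Finset.sum_le_sum fun t _ => pow_le_pow_left₀ (norm_nonneg _) (hva t _ ?_) 2
  have h1 : ‖z t - a t‖ ≤ 1 := by simpa [dist_eq_norm] using hz t (Set.mem_univ t)
  calc ‖w t + z t - a t‖ = ‖w t + (z t - a t)‖ := by rw [add_sub_assoc]
    _ ≤ 2 := (norm_add_le _ _).trans (by linarith [hw t])

/-- The probability that the gains are close to a given line. -/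
lemma exists_le_pi_tube {n : ℕ} (k : Fin (n + 1)) (a : Fin (n + 1) → ℂ) : ∃ c : ℝ, 0 < c ∧
    ∀ r : ℝ, 0 ≤ r → r ≤ 1 →
      ENNReal.ofReal (c * (r ^ 2) ^ n) ≤ (Measure.pi fun _ => complexGaussian)
        {h : Fin (n + 1) → ℂ | ‖h k‖ ≤ 1 ∧
          ∀ i, ‖h (k.succAbove i) - h k * a (k.succAbove i)‖ ≤ r} := by
  obtain ⟨c₀, hc₀, h₀⟩ := exists_le_complexGaussian_closedBall 0
  obtain ⟨c, hc, h⟩ := exists_le_complexGaussian_closedBall (∑ j, ‖a j‖)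
  refine ⟨c₀ * c ^ n, by positivity, fun r hr hr1 => ?_⟩
  set S : Set (ℂ × (Fin n → ℂ)) :=
    {q | ‖q.1‖ ≤ 1 ∧ ∀ i, ‖q.2 i - q.1 * a (k.succAbove i)‖ ≤ r}
  have hS : MeasurableSet S := by
    have h1 : MeasurableSet {q : ℂ × (Fin n → ℂ) | ‖q.1‖ ≤ 1} :=
      measurableSet_le (by fun_prop) (by fun_prop)
    have h2 : ∀ i, MeasurableSet {q : ℂ × (Fin n → ℂ) | ‖q.2 i - q.1 * a (k.succAbove i)‖ ≤ r} :=
      fun i => measurableSet_le (by fun_prop) (by fun_prop)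
    convert h1.inter (MeasurableSet.iInter h2) using 1
    ext q
    simp [S]
  -- The gain `h k` is split off. Given it, each of the other `n` gains must lie in a disc of radius
  -- `r`, whose centre is bounded because `‖h k‖ ≤ 1`.
  have hmp := (measurePreserving_piFinSuccAbove (fun _ : Fin (n + 1) => complexGaussian) k)
  have hpre := hmp.measure_preimage_equiv S
  refine le_of_le_of_eq ?_ hpre.symm
  refine le_trans ?_ (mul_le_prod_apply (t := Metric.closedBall 0 1)
    (c := ENNReal.ofReal ((c * r ^ 2) ^ n)) hS fun x hx => ?_)
  · rw [show c₀ * c ^ n * (r ^ 2) ^ n = c₀ * (c * r ^ 2) ^ n by rw [mul_pow]; ring,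
      ENNReal.ofReal_mul hc₀.le]
    gcongr
    simpa using h₀ 0 (by simp) 1 zero_le_one le_rfl
  · have hx1 : ‖x‖ ≤ 1 := by simpa using hx
    have := ofReal_pow_card_le_pi (ι := Fin n) (by positivity) fun i =>
      h (x * a (k.succAbove i)) (by
        rw [norm_mul]
        exact (mul_le_of_le_one_left (norm_nonneg _) hx1).trans
          (Finset.single_le_sum (f := fun j => ‖a j‖) (fun j _ => norm_nonneg _)
            (Finset.mem_univ _))) r hr hr1
    rw [Fintype.card_fin] at this
    refine this.trans (measure_mono fun z hz => ⟨hx1, fun i => ?_⟩)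
    simpa [dist_eq_norm] using hz i (Set.mem_univ i)

variable {N T₁ T₂ : ℕ}

lemma mulRealVec_sub (A : Matrix (Fin T₂) (Fin T₁ × Fin 2) ℂ) (x y : Fin T₁ × Fin 2 → ℝ) :
    mulRealVec A (x - y) = mulRealVec A x - mulRealVec A y := by
  rw [mulRealVec, mulRealVec, mulRealVec, ← Matrix.mulVec_sub]
  congr 1
  ext p
  simp

lemma euclidMetric_mulRealVec_add (H : Matrix (Fin T₂) (Fin T₁ × Fin 2) ℂ) (x₁ x₂ : Fin T₁ → ℂ)
    (n : Fin T₂ → ℂ) : euclidMetric H (mulRealVec H (realVec x₁) + n) x₂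
      = ∑ t, ‖mulRealVec H (realVec x₁ - realVec x₂) t + n t‖ ^ 2 := by
  rw [mulRealVec_sub]
  simp only [euclidMetric, Pi.add_apply, Pi.sub_apply]
  refine Finset.sum_congr rfl fun t _ => ?_
  congr 2
  ring

lemma euclidMetric_le_iff (H : Matrix (Fin T₂) (Fin T₁ × Fin 2) ℂ) (x₁ x₂ : Fin T₁ → ℂ)
    (n : Fin T₂ → ℂ) :
    euclidMetric H (mulRealVec H (realVec x₁) + n) x₂
        ≤ euclidMetric H (mulRealVec H (realVec x₁) + n) x₁
      ↔ ∑ t, ‖mulRealVec H (realVec x₁ - realVec x₂) t + n t‖ ^ 2 ≤ ∑ t, ‖n t‖ ^ 2 := by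
  have h0 : mulRealVec H 0 = 0 := by simpa using mulRealVec_sub H 0 0
  simp [euclidMetric_mulRealVec_add, h0]

lemma mulRealVec_smul_sum (A : Fin N → Matrix (Fin T₂) (Fin T₁ × Fin 2) ℂ) (κ : ℂ)
    (g : Fin N → ℂ) (x : Fin T₁ × Fin 2 → ℝ) (t : Fin T₂) :
    mulRealVec (κ • ∑ j, g j • A j) x t = κ * ∑ j, g j * mulRealVec (A j) x t := by
  simp [mulRealVec, Matrix.smul_mulVec, Matrix.sum_mulVec]

/-! ### The co-located system -/

/-- The columns `A j (x₁ - x₂)` of the codeword difference. -/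
noncomputable def codeDiff (A : Fin N → Matrix (Fin T₂) (Fin T₁ × Fin 2) ℂ) (x₁ x₂ : Fin T₁ → ℂ) :
    Fin N → Fin T₂ → ℂ :=
  fun j => mulRealVec (A j) (realVec x₁ - realVec x₂)

lemma coPEP_eq (A : Fin N → Matrix (Fin T₂) (Fin T₁ × Fin 2) ℂ) (x₁ x₂ : Fin T₁ → ℂ) (Et : ℝ) :
    coPEP A x₁ x₂ Et = (coMeasure N T₂).real {ω | ∑ t, ‖(√Et : ℂ) *
      (∑ j, ω.1 j * codeDiff A x₁ x₂ j t) + ω.2 t‖ ^ 2 ≤ ∑ t, ‖ω.2 t‖ ^ 2} := by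
  rw [coPEP]
  congr 1
  ext ω
  simp only [Set.mem_ofPred_eq, coReceived, euclidMetric_le_iff]
  simp only [coHeq, mulRealVec_smul_sum, codeDiff]

instance : IsProbabilityMeasure (coMeasure N T₂) := by unfold coMeasure; infer_instance

instance : IsProbabilityMeasure (relayMeasure N T₁ T₂) := by unfold relayMeasure; infer_instance

/-- A rank-deficient codeword difference loses diversity. -/
lemma linearIndependent_codeDiff {A : Fin N → Matrix (Fin T₂) (Fin T₁ × Fin 2) ℂ}
    {x₁ x₂ : Fin T₁ → ℂ} (hd : HasDiversityOrder (coPEP A x₁ x₂) N) :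
    LinearIndependent ℂ (codeDiff A x₁ x₂) := by
  by_contra hli
  obtain ⟨g, hg, k, hk⟩ := Fintype.not_linearIndependent_iff.1 hli
  obtain _ | n := N
  · exact k.elim0
  set u := codeDiff A x₁ x₂
  obtain ⟨c, hc, htube⟩ := exists_le_pi_tube k fun j => g j / g k
  set C : ℝ := ∑ t, ∑ j, ‖u j t‖
  obtain ⟨c', hc', herr⟩ := exists_le_pi_error T₂ (show 0 ≤ C by positivity)
  -- Here `N = n + 1`: the tube of radius `E^(-1/2)` about the line spanned by `g` constrains only
  -- `n` complex coordinates.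
  refine not_hasDiversityOrder_of_le (d' := n) (by simp) (mul_pos hc hc') ?_ hd
  filter_upwards [eventually_ge_atTop 1] with E hE
  have hE0 : 0 < E := by linarith
  have hs1 : 1 ≤ √E := Real.one_le_sqrt.2 hE
  have hr : ((√E)⁻¹ ^ 2) ^ n = E ^ (-(n : ℝ)) := by
    rw [inv_pow, Real.sq_sqrt hE0.le, Real.rpow_neg hE0.le, Real.rpow_natCast, inv_pow]
  have ht := htube (√E)⁻¹ (by positivity) (inv_le_one_of_one_le₀ hs1)
  rw [coPEP_eq, measureReal_def, ← ENNReal.ofReal_le_iff_le_toReal (measure_ne_top _ _), ← hr,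
    show c * c' * ((√E)⁻¹ ^ 2) ^ n = c * ((√E)⁻¹ ^ 2) ^ n * c' by ring,
    ENNReal.ofReal_mul (by positivity)]
  refine (mul_le_mul_left ht _).trans (mul_le_prod_apply
    (measurableSet_le (by fun_prop) (by fun_prop)) fun h hh => ?_)
  have key := herr (fun t => (√E : ℂ) * ∑ j, h j * u j t) 0 (fun t => ?_) (by simp)
  · simpa using key
  -- Subtracting a multiple of the relation leaves only the deviations from the line, which cancel
  -- the factor `√E`.
  have hsum : ∑ j, h j * u j t = ∑ j, (h j - h k * (g j / g k)) * u j t := by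
    have h0 := congrFun hg t
    simp only [Finset.sum_apply, Pi.smul_apply, smul_eq_mul, Pi.zero_apply] at h0
    have h1 : ∑ j, h k * (g j / g k) * u j t = 0 := by
      calc _ = (h k / g k) * ∑ j, g j * u j t := by
            rw [Finset.mul_sum]; exact Finset.sum_congr rfl fun j _ => by ring
        _ = 0 := by rw [h0, mul_zero]
    simp only [sub_mul, Finset.sum_sub_distrib, h1, sub_zero]
  have hdev : ∀ j, ‖h j - h k * (g j / g k)‖ ≤ (√E)⁻¹ := by
    intro j
    rcases eq_or_ne j k with rfl | hjk
    · rw [div_self hk]; simp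
    · obtain ⟨i, rfl⟩ := Fin.exists_succAbove_eq hjk
      exact hh.2 i
  rw [hsum, norm_mul, Complex.norm_real, Real.norm_of_nonneg (by positivity)]
  calc √E * ‖∑ j, (h j - h k * (g j / g k)) * u j t‖ ≤ √E * ∑ j, (√E)⁻¹ * ‖u j t‖ := by
        gcongr
        refine norm_sum_le_of_le _ fun j _ => ?_
        rw [norm_mul]
        exact mul_le_mul_of_nonneg_right (hdev j) (norm_nonneg _)
    _ = ∑ j, ‖u j t‖ := by rw [← Finset.mul_sum, mul_inv_cancel_left₀ (by positivity)]
    _ ≤ C := Finset.single_le_sum (f := fun t => ∑ j, ‖u j t‖) (fun t _ => by positivity)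
        (Finset.mem_univ t)

/-- An injective linear map on a finite-dimensional space is bounded below. -/
lemma exists_norm_le_of_linearIndependent {u : Fin N → Fin T₂ → ℂ} (hu : LinearIndependent ℂ u) :
    ∃ K : ℝ, 0 < K ∧ ∀ g : Fin N → ℂ, ‖g‖ ≤ K * ‖fun t => ∑ j, g j * u j t‖ := by
  obtain ⟨K, hK, h⟩ := LinearMap.exists_antilipschitzWith (Fintype.linearCombination ℂ u)
    (LinearMap.ker_eq_bot.2 (hu.fintypeLinearCombination_injective))
  refine ⟨K, hK, fun g => ?_⟩
  have := h.le_mul_dist g 0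
  rw [map_zero, dist_zero_right, dist_zero_right] at this
  have e : (fun t => ∑ j, g j * u j t) = Fintype.linearCombination ℂ u g := by
    ext t
    simp [Fintype.linearCombination_apply]
  rwa [e]

/-! ### The relay system -/

lemma gain_nonneg (M : ℕ) (Et : ℝ) : 0 ≤ gain M Et := Real.sqrt_nonneg _

lemma gain_le_one {M : ℕ} (hM : 0 < M) {Et : ℝ} (hE : 0 ≤ Et) : gain M Et ≤ 1 := by
  have hM1 : (1 : ℝ) ≤ M := by exact_mod_cast hM
  rw [gain, Real.sqrt_le_one, energyTwo, energyOne, div_le_one (by positivity)]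
  calc Et / (2 * M) ≤ Et / 2 := div_le_div_of_nonneg_left hE two_pos (by linarith)
    _ ≤ _ := by linarith

lemma gain_mul_sqrt_le {M : ℕ} (hM : 0 < M) {Et : ℝ} (hE : 0 ≤ Et) :
    gain M Et * √(energyOne Et) ≤ √Et := by
  refine (mul_le_of_le_one_left (Real.sqrt_nonneg _) (gain_le_one hM hE)).trans
    (Real.sqrt_le_sqrt ?_)
  rw [energyOne]; linarith

/-- For `Et ≥ 2` one has `Et / 2 + 1 ≤ Et`, so the two-hop amplitude is still of order `√Et`. -/
lemma le_gain_mul_sqrt {M : ℕ} (hM : 0 < M) {Et : ℝ} (hE : 2 ≤ Et) :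
    √(1 / (4 * M)) * √Et ≤ gain M Et * √(energyOne Et) := by
  have hM1 : (0 : ℝ) < M := by exact_mod_cast hM
  have hE0 : 0 < Et := by linarith
  rw [gain, ← Real.sqrt_mul (by positivity),
    ← Real.sqrt_mul (by rw [energyTwo, energyOne]; positivity)]
  refine Real.sqrt_le_sqrt ?_
  rw [energyTwo, energyOne]
  calc 1 / (4 * M) * Et = Et / (2 * M) / Et * (Et / 2) := by field_simp; norm_num
    _ ≤ Et / (2 * M) / (Et / 2 + 1) * (Et / 2) := by gcongr; linarith

/-- The part of the total noise that is forwarded by the relays. -/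
noncomputable def relayNoise (A : Fin N → Matrix (Fin T₂) (Fin T₁ × Fin 2) ℂ) (G : ℝ)
    (hd : Fin N → ℂ) (z : Fin N → Fin T₁ → ℂ) : Fin T₂ → ℂ :=
  fun t => ∑ j, hd j * mulRealVec (A j) (realVec fun i => (G : ℂ) * z j i) t

lemma totalNoise_apply (A : Fin N → Matrix (Fin T₂) (Fin T₁ × Fin 2) ℂ) (M : ℕ) (Et : ℝ)
    (hd : Fin N → ℂ) (z : Fin N → Fin T₁ → ℂ) (zd : Fin T₂ → ℂ) (t : Fin T₂) :
    totalNoise A M Et hd z zd t = relayNoise A (gain M Et) hd z t + zd t := by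
  simp [totalNoise, relayNoise]

lemma abs_realVec_le (x : Fin T₁ → ℂ) (p : Fin T₁ × Fin 2) : |realVec x p| ≤ ‖x p.1‖ := by
  obtain ⟨i, a⟩ := p
  fin_cases a
  · simpa [realVec] using Complex.abs_re_le_norm _
  · simpa [realVec] using Complex.abs_im_le_norm _

lemma norm_relayNoise_le (A : Fin N → Matrix (Fin T₂) (Fin T₁ × Fin 2) ℂ) {G : ℝ} (hG : 0 ≤ G)
    (hG1 : G ≤ 1) {hd : Fin N → ℂ} {z : Fin N → Fin T₁ → ℂ} {B : ℝ}
    (h : ∀ j i, ‖hd j‖ * ‖z j i‖ ≤ B) (t : Fin T₂) :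
    ‖relayNoise A G hd z t‖ ≤ (∑ j, ∑ p, ‖A j t p‖) * B := by
  rw [relayNoise, Finset.sum_mul]
  refine norm_sum_le_of_le _ fun j _ => ?_
  rw [mulRealVec, Matrix.mulVec, dotProduct, Finset.mul_sum, Finset.sum_mul]
  refine norm_sum_le_of_le _ fun p _ => ?_
  rw [norm_mul, norm_mul, Complex.norm_real, mul_left_comm]
  refine mul_le_mul_of_nonneg_left (le_trans ?_ (h j p.1)) (norm_nonneg _)
  refine mul_le_mul_of_nonneg_left ((abs_realVec_le _ p).trans ?_) (norm_nonneg _)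
  rw [norm_mul, Complex.norm_real, Real.norm_of_nonneg hG]
  exact mul_le_of_le_one_left (norm_nonneg _) hG1

lemma measurable_relayNoise (A : Fin N → Matrix (Fin T₂) (Fin T₁ × Fin 2) ℂ) (G : ℝ)
    (t : Fin T₂) :
    Measurable fun q : (Fin N → ℂ) × (Fin N → Fin T₁ → ℂ) => relayNoise A G q.1 q.2 t := by
  have h : ∀ j p, Measurable fun q : (Fin N → ℂ) × (Fin N → Fin T₁ → ℂ) =>
      ((realVec (fun i => (G : ℂ) * q.2 j i) p : ℝ) : ℂ) := by
    rintro j ⟨i, a⟩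
    fin_cases a
    · simp only [realVec, Fin.zero_eta, Matrix.cons_val_zero]
      fun_prop
    · simp only [realVec, Fin.mk_one, Matrix.cons_val_one, Matrix.cons_val_fin_one]
      fun_prop
  simp only [relayNoise, mulRealVec, Matrix.mulVec, dotProduct]
  fun_prop

/-- The event of a pairwise error in the relay system. -/
def relayErrorSet (A : Fin N → Matrix (Fin T₂) (Fin T₁ × Fin 2) ℂ) (M : ℕ) (x₁ x₂ : Fin T₁ → ℂ)
    (Et : ℝ) : Set (RelaySpace N T₁ T₂) :=
  {ω | ∑ t, ‖((gain M Et * √(energyOne Et) : ℝ) : ℂ) *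
        (∑ j, ((‖ω.1 j‖ : ℂ) * ω.2.1 j) * codeDiff A x₁ x₂ j t)
        + (relayNoise A (gain M Et) ω.2.1 ω.2.2.1 t + ω.2.2.2 t)‖ ^ 2
      ≤ ∑ t, ‖relayNoise A (gain M Et) ω.2.1 ω.2.2.1 t + ω.2.2.2 t‖ ^ 2}

lemma relayErrorSet_eq (A : Fin N → Matrix (Fin T₂) (Fin T₁ × Fin 2) ℂ) (M : ℕ)
    (x₁ x₂ : Fin T₁ → ℂ) (Et : ℝ) :
    {ω | euclidMetric (relayChannel A M Et ω) (relayReceived A M Et x₁ ω) x₂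
      ≤ euclidMetric (relayChannel A M Et ω) (relayReceived A M Et x₁ ω) x₁}
      = relayErrorSet A M x₁ x₂ Et := by
  ext ω
  simp only [Set.mem_ofPred_eq, relayReceived, euclidMetric_le_iff, relayErrorSet]
  simp only [relayChannel, relayHeq, mulRealVec_smul_sum, codeDiff, totalNoise_apply]

lemma measurableSet_relayErrorSet (A : Fin N → Matrix (Fin T₂) (Fin T₁ × Fin 2) ℂ) (M : ℕ)
    (x₁ x₂ : Fin T₁ → ℂ) (Et : ℝ) : MeasurableSet (relayErrorSet A M x₁ x₂ Et) := by
  have h : ∀ t, Measurable fun ω : RelaySpace N T₁ T₂ =>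
      relayNoise A (gain M Et) ω.2.1 ω.2.2.1 t := fun t =>
    (measurable_relayNoise A (gain M Et) t).comp (by fun_prop :
      Measurable fun ω : RelaySpace N T₁ T₂ => (ω.2.1, ω.2.2.1))
  exact measurableSet_le (by fun_prop) (by fun_prop)

/-- If the codeword difference has full rank then a pairwise error requires all the products of
the gains to be small. -/
lemma exists_relayErrorSet_subset {A : Fin N → Matrix (Fin T₂) (Fin T₁ × Fin 2) ℂ} {M : ℕ}
    (hM : 0 < M) {x₁ x₂ : Fin T₁ → ℂ} (hu : LinearIndependent ℂ (codeDiff A x₁ x₂)) :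
    ∃ k : ℝ, 0 < k ∧ ∀ Et : ℝ, 2 ≤ Et → relayErrorSet A M x₁ x₂ Et ⊆
      {ω | ∀ j, k * √Et * ‖ω.1 j‖ * ‖ω.2.1 j‖ ≤ noiseBound ω} := by
  have hM1 : (0 : ℝ) < M := by exact_mod_cast hM
  obtain ⟨K, hK, hKu⟩ := exists_norm_le_of_linearIndependent hu
  set D : ℝ := ∑ t, ∑ j, ∑ p, ‖A j t p‖
  have hD0 : 0 ≤ D := by positivity
  set m : ℝ := √(1 / (4 * M))
  have hm : 0 < m := by positivity
  -- `K` inverts the code difference, `2 * (T₂ + 1)` compares signal with noise, and `D + 1` bounds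
  -- forwarded plus local noise in units of `W`.
  set L : ℝ := K * (2 * (T₂ + 1) * (D + 1))
  have hL : 0 < L := by positivity
  refine ⟨m / L, by positivity, fun E hE ω hω j => ?_⟩
  have hE0 : 0 < E := by linarith
  set W := noiseBound ω
  have hW : 1 ≤ W := one_le_noiseBound ω
  have hn : ∀ t, ‖relayNoise A (gain M E) ω.2.1 ω.2.2.1 t + ω.2.2.2 t‖ ≤ (D + 1) * W := by
    intro t
    refine (norm_add_le _ _).trans ?_
    rw [add_mul, one_mul]
    refine add_le_add ((norm_relayNoise_le A (gain_nonneg _ _) (gain_le_one hM hE0.le)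
      (norm_mul_norm_le_noiseBound ω) t).trans ?_) (norm_le_noiseBound ω t)
    exact mul_le_mul_of_nonneg_right (Finset.single_le_sum
      (f := fun t => ∑ j, ∑ p, ‖A j t p‖) (fun t _ => by positivity) (Finset.mem_univ t))
      (by positivity)
  set κ := gain M E * √(energyOne E)
  have hκ : m * √E ≤ κ := le_gain_mul_sqrt hM hE
  have hv := norm_le_of_sum_norm_add_sq_le (by positivity) hn hω
  set g : Fin N → ℂ := fun j => (‖ω.1 j‖ : ℂ) * ω.2.1 j
  have hκ0 : 0 ≤ κ := le_trans (by positivity) hκ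
  have hg : κ * ‖fun t => ∑ j, g j * codeDiff A x₁ x₂ j t‖ ≤ 2 * (T₂ + 1) * ((D + 1) * W) := by
    have e : κ * ‖fun t => ∑ j, g j * codeDiff A x₁ x₂ j t‖
        = ‖(κ : ℂ) • fun t => ∑ j, g j * codeDiff A x₁ x₂ j t‖ := by
      rw [norm_smul, Complex.norm_real, Real.norm_of_nonneg hκ0]
    rw [e, pi_norm_le_iff_of_nonneg (by positivity)]
    exact hv
  have hgj : ‖ω.1 j‖ * ‖ω.2.1 j‖ ≤ K * ‖fun t => ∑ j, g j * codeDiff A x₁ x₂ j t‖ := by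
    refine le_trans (le_of_eq ?_) ((norm_le_pi_norm g j).trans (hKu g))
    simp [g]
  rw [mul_assoc, div_mul_eq_mul_div, div_mul_eq_mul_div, div_le_iff₀ hL]
  calc m * √E * (‖ω.1 j‖ * ‖ω.2.1 j‖)
      ≤ κ * (K * ‖fun t => ∑ j, g j * codeDiff A x₁ x₂ j t‖) := by gcongr
    _ = K * (κ * ‖fun t => ∑ j, g j * codeDiff A x₁ x₂ j t‖) := by ring
    _ ≤ K * (2 * (T₂ + 1) * ((D + 1) * W)) := by gcongr
    _ = W * L := by simp only [L]; ring

/-- Each of the `N` small products contributes `(√E)^(-2s) = E^(-s)`. For `d > 0` the choice is `s =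
d / N < 1`; otherwise `s = 0`. -/
lemma exists_relayErrorSet_le {A : Fin N → Matrix (Fin T₂) (Fin T₁ × Fin 2) ℂ} {M : ℕ}
    (hM : 0 < M) {x₁ x₂ : Fin T₁ → ℂ} (hu : LinearIndependent ℂ (codeDiff A x₁ x₂)) {d : ℝ}
    (hd : d < N) : ∃ C : ℝ, 0 < C ∧ ∀ᶠ E in atTop,
      (relayMeasure N T₁ T₂).real (relayErrorSet A M x₁ x₂ E) ≤ C * E ^ (-d) := by
  obtain ⟨s, hs, hs1, hds⟩ : ∃ s : ℝ, 0 ≤ s ∧ s < 1 ∧ d ≤ N * s := by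
    rcases le_or_gt d 0 with h0 | h0
    · exact ⟨0, le_rfl, one_pos, by simpa using h0⟩
    · have hN : (0 : ℝ) < N := h0.trans hd
      exact ⟨d / N, by positivity, (div_lt_one hN).2 hd, by rw [mul_div_cancel₀ _ hN.ne']⟩
  obtain ⟨k, hk, hsub⟩ := exists_relayErrorSet_subset (M := M) hM hu
  obtain ⟨C, hC, hle⟩ := exists_relayMeasure_le N T₁ T₂ hs hs1
  refine ⟨(k ^ (-(2 * s))) ^ N * (C.toReal + 1), by positivity, ?_⟩
  filter_upwards [eventually_ge_atTop 2] with E hE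
  have hE0 : 0 < E := by linarith
  have h := (measure_mono (hsub E hE)).trans (hle (k * √E) (by positivity))
  rw [ENNReal.ofReal_rpow_of_pos (by positivity), ← ENNReal.ofReal_pow (by positivity)] at h
  have h' := ENNReal.toReal_mono (by finiteness) h
  rw [ENNReal.toReal_mul, ENNReal.toReal_ofReal (by positivity)] at h'
  rw [measureReal_def]
  have e : (√E ^ (-(2 * s))) ^ N = E ^ (-(N * s)) := by
    rw [Real.sqrt_eq_rpow, ← Real.rpow_mul hE0.le, ← Real.rpow_natCast, ← Real.rpow_mul hE0.le]
    congr 1; ring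
  rw [Real.mul_rpow hk.le (Real.sqrt_nonneg _), mul_pow, e] at h'
  calc _ ≤ _ := h'
    _ ≤ (k ^ (-(2 * s))) ^ N * E ^ (-d) * (C.toReal + 1) := by
        gcongr
        · linarith
        · simp
    _ = _ := by ring

/-- A lower bound for the probability of an event from one for the conditional probability given
the gains and the relay noise. -/
lemma mul_le_relayMeasure {s : Set (RelaySpace N T₁ T₂)} (hs : MeasurableSet s)
    {t₁ t₂ : Set (Fin N → ℂ)} {t₃ : Set (Fin N → Fin T₁ → ℂ)} {c : ℝ≥0∞}
    (h : ∀ x ∈ t₁, ∀ y ∈ t₂, ∀ z ∈ t₃, c ≤ (Measure.pi fun _ => complexGaussian)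
      {w : Fin T₂ → ℂ | (x, y, z, w) ∈ s}) :
    (Measure.pi fun _ => complexGaussian) t₁ * ((Measure.pi fun _ => complexGaussian) t₂ *
      ((Measure.pi fun _ => Measure.pi fun _ => complexGaussian) t₃ * c))
      ≤ relayMeasure N T₁ T₂ s :=
  mul_le_prod_apply hs fun x hx =>
    mul_le_prod_apply (measurable_prodMk_left hs) fun y hy =>
      mul_le_prod_apply (measurable_prodMk_left (measurable_prodMk_left hs)) fun z hz =>
        h x hx y hy z hz

/-- If the relay-to-destination gains are of order `Et⁻¹ᐟ²` then an error has a probability bounded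
away from zero. -/
lemma exists_le_pi_relayErrorSet (A : Fin N → Matrix (Fin T₂) (Fin T₁ × Fin 2) ℂ) {M : ℕ}
    (hM : 0 < M) (x₁ x₂ : Fin T₁ → ℂ) : ∃ c : ℝ, 0 < c ∧ ∀ᶠ E in atTop,
      ∀ (hs hd : Fin N → ℂ) (z : Fin N → Fin T₁ → ℂ), (∀ j, ‖hs j‖ ≤ 1) →
        (∀ j, ‖hd j‖ ≤ (√E)⁻¹) → (∀ j i, ‖z j i‖ ≤ 1) →
        ENNReal.ofReal c ≤ (Measure.pi fun _ => complexGaussian)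
          {w : Fin T₂ → ℂ | (hs, hd, z, w) ∈ relayErrorSet A M x₁ x₂ E} := by
  set u := codeDiff A x₁ x₂
  set C : ℝ := ∑ t, ∑ j, ‖u j t‖
  set D : ℝ := ∑ t, ∑ j, ∑ p, ‖A j t p‖
  obtain ⟨c, hc, herr⟩ := exists_le_pi_error T₂ (show 0 ≤ C by positivity)
  refine ⟨c, hc, ?_⟩
  -- For `E ≥ D ^ 2` the forwarded noise, at most `D / √E`, is bounded by 1.
  filter_upwards [eventually_ge_atTop 1, eventually_ge_atTop (D ^ 2)] with E hE hED hs hd z hhs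
    hhd hz
  have hE0 : 0 < E := by linarith
  have hDE : D ≤ √E := Real.le_sqrt_of_sq_le hED
  have hs0 : 0 < √E := Real.sqrt_pos.2 hE0
  refine herr (fun t => ((gain M E * √(energyOne E) : ℝ) : ℂ) *
    ∑ j, ((‖hs j‖ : ℂ) * hd j) * u j t) (relayNoise A (gain M E) hd z) (fun t => ?_) fun t => ?_
  · rw [norm_mul, Complex.norm_real, Real.norm_of_nonneg
      (mul_nonneg (gain_nonneg _ _) (Real.sqrt_nonneg _))]
    calc gain M E * √(energyOne E) * ‖∑ j, ((‖hs j‖ : ℂ) * hd j) * u j t‖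
        ≤ √E * ∑ j, (√E)⁻¹ * ‖u j t‖ := by
          refine mul_le_mul (gain_mul_sqrt_le hM hE0.le) ?_ (norm_nonneg _) hs0.le
          refine norm_sum_le_of_le _ fun j _ => ?_
          rw [norm_mul, norm_mul, Complex.norm_real, norm_norm]
          refine mul_le_mul_of_nonneg_right ?_ (norm_nonneg _)
          exact (mul_le_of_le_one_left (norm_nonneg _) (hhs j)).trans (hhd j)
      _ = ∑ j, ‖u j t‖ := by rw [← Finset.mul_sum, mul_inv_cancel_left₀ hs0.ne']
      _ ≤ C := Finset.single_le_sum (f := fun t => ∑ j, ‖u j t‖) (fun t _ => by positivity)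
        (Finset.mem_univ t)
  · have hn := norm_relayNoise_le A (gain_nonneg M E) (gain_le_one hM hE0.le)
      (hd := hd) (z := z) (fun j i => (mul_le_of_le_one_right (norm_nonneg _) (hz j i)).trans
        (hhd j)) t
    refine hn.trans ?_
    calc (∑ j, ∑ p, ‖A j t p‖) * (√E)⁻¹ ≤ √E * (√E)⁻¹ := by
          refine mul_le_mul_of_nonneg_right (le_trans ?_ hDE) (inv_nonneg.2 hs0.le)
          exact Finset.single_le_sum (f := fun t => ∑ j, ∑ p, ‖A j t p‖)
            (fun t _ => by positivity) (Finset.mem_univ t)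
      _ = 1 := mul_inv_cancel₀ hs0.ne'

/-- A deep fade of the second hop alone suffices: first-hop gains and relay noise stay in unit discs
at constant cost, and each `|h_{jd}| ≤ E^(-1/2)` costs a factor of order `E⁻¹`. -/
lemma exists_le_relayErrorSet (A : Fin N → Matrix (Fin T₂) (Fin T₁ × Fin 2) ℂ) {M : ℕ}
    (hM : 0 < M) (x₁ x₂ : Fin T₁ → ℂ) : ∃ c : ℝ, 0 < c ∧ ∀ᶠ E in atTop,
      c * E ^ (-(N : ℝ)) ≤ (relayMeasure N T₁ T₂).real (relayErrorSet A M x₁ x₂ E) := by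
  obtain ⟨b, hb, hball⟩ := exists_le_complexGaussian_closedBall 0
  obtain ⟨c, hc, herr⟩ := exists_le_pi_relayErrorSet A hM x₁ x₂
  have hbox : ∀ (n : ℕ) (r : ℝ), 0 ≤ r → r ≤ 1 → ENNReal.ofReal ((b * r ^ 2) ^ n) ≤
      (Measure.pi fun _ : Fin n => complexGaussian)
        (Set.univ.pi fun _ => Metric.closedBall (0 : ℂ) r) := fun n r hr hr1 => by
    simpa only [Fintype.card_fin] using ofReal_pow_card_le_pi (ι := Fin n) (by positivity)
      fun _ => hball 0 (by simp) r hr hr1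
  have hbox' : ENNReal.ofReal ((b ^ T₁) ^ N) ≤
      (Measure.pi fun _ : Fin N => Measure.pi fun _ : Fin T₁ => complexGaussian)
        (Set.univ.pi fun _ => Set.univ.pi fun _ => Metric.closedBall (0 : ℂ) 1) := by
    have h1 := hbox T₁ 1 zero_le_one le_rfl
    rw [one_pow, mul_one] at h1
    rw [Measure.pi_pi, ENNReal.ofReal_pow (by positivity), Finset.prod_const, Finset.card_univ,
      Fintype.card_fin]
    exact pow_le_pow_left' h1 N
  refine ⟨b ^ N * (b ^ N * ((b ^ T₁) ^ N * c)), by positivity, ?_⟩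
  filter_upwards [eventually_ge_atTop 1, herr] with E hE herr
  have hE0 : 0 < E := by linarith
  have hr : (b * (√E)⁻¹ ^ 2) ^ N = b ^ N * E ^ (-(N : ℝ)) := by
    rw [inv_pow, Real.sq_sqrt hE0.le, Real.rpow_neg hE0.le, Real.rpow_natCast, mul_pow, inv_pow]
  have h1 := hbox N 1 zero_le_one le_rfl
  have h2 := hbox N (√E)⁻¹ (by positivity) (inv_le_one_of_one_le₀ (Real.one_le_sqrt.2 hE))
  rw [one_pow, mul_one] at h1
  rw [hr] at h2
  rw [measureReal_def, ← ENNReal.ofReal_le_iff_le_toReal (measure_ne_top _ _),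
    show b ^ N * (b ^ N * ((b ^ T₁) ^ N * c)) * E ^ (-(N : ℝ))
      = b ^ N * ((b ^ N * E ^ (-(N : ℝ))) * ((b ^ T₁) ^ N * c)) by ring,
    ENNReal.ofReal_mul (by positivity),
    ENNReal.ofReal_mul (p := b ^ N * E ^ (-(N : ℝ))) (by positivity),
    ENNReal.ofReal_mul (p := (b ^ T₁) ^ N) (by positivity)]
  refine (mul_le_mul' h1 (mul_le_mul' h2 (mul_le_mul' hbox' le_rfl))).trans
    (mul_le_relayMeasure (measurableSet_relayErrorSet A M x₁ x₂ E) fun hs hhs hd hhd z hz =>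
      herr hs hd z (fun j => ?_) (fun j => ?_) fun j i => ?_)
  · simpa using hhs j (Set.mem_univ j)
  · simpa using hhd j (Set.mem_univ j)
  · simpa using hz j (Set.mem_univ j) i (Set.mem_univ i)

/-! ### Single-symbol decodability -/

/-- The metric splits as soon as `Re (Hᴴ H)` is block diagonal. -/
lemma euclidMetric_eq_sum_symbolMetric {H : Matrix (Fin T₂) (Fin T₁ × Fin 2) ℂ}
    (hH : ∀ l l' : Fin T₁, l ≠ l' → ∀ a b, matRe (Hᴴ * H) (l, a) (l', b) = 0)
    (y : Fin T₂ → ℂ) (x : Fin T₁ → ℂ) :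
    euclidMetric H y x = (∑ t, ‖y t‖ ^ 2) + ∑ l, symbolMetric H y l (x l) := by
  set r := realVec x
  set w := mulRealVec H r
  have hw : star w = (fun p => (r p : ℂ)) ᵥ* Hᴴ := by
    rw [show w = H *ᵥ fun p => (r p : ℂ) from rfl, Matrix.star_mulVec]
    congr 1
    ext p
    simp
  have h1 : ∑ t, (star (w t) * y t).re = ∑ p, r p * ((Hᴴ *ᵥ y) p).re := by
    have : star w ⬝ᵥ y = (fun p => (r p : ℂ)) ⬝ᵥ (Hᴴ *ᵥ y) := by
      rw [hw, Matrix.dotProduct_mulVec]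
    have := congrArg Complex.re this
    simpa [dotProduct, Complex.re_sum] using this
  have h2 : ∑ t, ‖w t‖ ^ 2 = ∑ p, ∑ q, r p * matRe (Hᴴ * H) p q * r q := by
    have : star w ⬝ᵥ w = (fun p => (r p : ℂ)) ⬝ᵥ ((Hᴴ * H) *ᵥ fun p => (r p : ℂ)) := by
      rw [hw, ← Matrix.mulVec_mulVec, Matrix.dotProduct_mulVec]
      rfl
    have := congrArg Complex.re this
    simp only [dotProduct, Matrix.mulVec, Complex.re_sum, Complex.re_ofReal_mul,
      Complex.re_mul_ofReal, Finset.mul_sum] at this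
    calc ∑ t, ‖w t‖ ^ 2 = ∑ t, (star w t * w t).re := by
          refine Finset.sum_congr rfl fun t _ => ?_
          rw [← Complex.normSq_eq_norm_sq]
          simp [Complex.normSq_apply]
      _ = _ := this
      _ = _ := by simp [matRe, mul_assoc]
  have h3 : euclidMetric H y x
      = ∑ t, ‖y t‖ ^ 2 + (-2 * ∑ t, (star (w t) * y t).re + ∑ t, ‖w t‖ ^ 2) := by
    rw [euclidMetric, Finset.mul_sum, ← Finset.sum_add_distrib, ← Finset.sum_add_distrib]
    refine Finset.sum_congr rfl fun t _ => ?_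
    rw [← Complex.normSq_eq_norm_sq, ← Complex.normSq_eq_norm_sq, ← Complex.normSq_eq_norm_sq]
    change Complex.normSq (y t - w t) = _
    simp [Complex.normSq_apply]
    ring
  rw [h3, h1, h2]
  congr 1
  simp only [symbolMetric, Finset.sum_add_distrib, ← Finset.mul_sum, Fintype.sum_prod_type]
  congr 1
  refine Finset.sum_congr rfl fun l _ => Finset.sum_congr rfl fun a _ => ?_
  rw [Finset.sum_eq_single l]
  · rfl
  · intro l' _ hl'
    refine Finset.sum_eq_zero fun b _ => ?_
    rw [hH l l' hl'.symm, mul_zero, zero_mul]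
  · simp

/-- The entry is `κ²` times the real part of `∑ conj(g i) g j s i j`, with `s i j` the entry of `Aᵢᴴ
Aⱼ`. Off the blocks, SSD makes `Re s` antisymmetric and `Im s` symmetric in `i, j`. As `conj(g i) g
j` is Hermitian, the real parts of the `(i, j)` and `(j, i)` terms cancel. -/
lemma matRe_smul_sum_offDiagonal {A : Fin N → Matrix (Fin T₂) (Fin T₁ × Fin 2) ℂ}
    (hA : SSDConditions A) (κ : ℝ) (g : Fin N → ℂ) {l l' : Fin T₁} (hl : l ≠ l') (a b : Fin 2) :
    matRe (((κ : ℂ) • ∑ j, g j • A j)ᴴ * ((κ : ℂ) • ∑ j, g j • A j)) (l, a) (l', b) = 0 := by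
  obtain ⟨h1, h2, h3⟩ := hA
  set s : Fin N → Fin N → ℂ := fun i j => ∑ t, star (A i t (l, a)) * A j t (l', b) with hs
  have k1 : ∀ j, (s j j).re = 0 := fun j => by
    have := (h1 j).1 l l' hl a b
    simpa [matRe, matIm, Matrix.mul_apply, hs, Complex.re_sum, Finset.sum_add_distrib] using this
  have k2 : ∀ i j, (s i j).re + (s j i).re = 0 := fun i j => by
    rcases eq_or_ne i j with rfl | hij
    · simp [k1]
    have := (h2 i j hij).1 l l' hl a b
    simp only [matRe, matIm, Matrix.add_apply, Matrix.mul_apply, Matrix.transpose_apply,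
      Matrix.map_apply] at this
    simp only [hs, Complex.re_sum, Complex.mul_re, Complex.star_def, Complex.conj_re,
      Complex.conj_im, Finset.sum_sub_distrib, neg_mul, Finset.sum_neg_distrib]
    linarith
  have k3 : ∀ i j, (s i j).im - (s j i).im = 0 := fun i j => by
    rcases eq_or_ne i j with rfl | hij
    · simp
    have := (h3 i j hij).1 l l' hl a b
    simp only [matRe, matIm, Matrix.add_apply, Matrix.sub_apply, Matrix.mul_apply,
      Matrix.transpose_apply, Matrix.map_apply] at this
    simp only [hs, Complex.im_sum, Complex.mul_im, Complex.star_def, Complex.conj_re,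
      Complex.conj_im, Finset.sum_add_distrib, neg_mul, Finset.sum_neg_distrib]
    linarith
  have hsum : (∑ i, ∑ j, star (g i) * g j * s i j).re = 0 := by
    have hswap : ∑ i, ∑ j, star (g i) * g j * s i j = ∑ i, ∑ j, star (g j) * g i * s j i :=
      Finset.sum_comm
    have hadd : (∑ i, ∑ j, star (g i) * g j * s i j).re
        + (∑ i, ∑ j, star (g j) * g i * s j i).re = 0 := by
      simp only [Complex.re_sum, ← Finset.sum_add_distrib]
      refine Finset.sum_eq_zero fun i _ => Finset.sum_eq_zero fun j _ => ?_
      have e2 := k2 i j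
      have e3 := k3 i j
      simp only [Complex.mul_re, Complex.mul_im, Complex.star_def, Complex.conj_re, Complex.conj_im]
      linear_combination ((g i).re * (g j).re + (g i).im * (g j).im) * e2
        - ((g i).re * (g j).im - (g i).im * (g j).re) * e3
    rw [← hswap] at hadd
    linarith
  have hentry : (((κ : ℂ) • ∑ j, g j • A j)ᴴ * ((κ : ℂ) • ∑ j, g j • A j)) (l, a) (l', b)
      = ((κ ^ 2 : ℝ) : ℂ) * ∑ i, ∑ j, star (g i) * g j * s i j := by
    simp only [Matrix.mul_apply, Matrix.conjTranspose_apply, Matrix.smul_apply, Matrix.sum_apply,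
      smul_eq_mul, star_mul', star_sum, hs, Finset.mul_sum, Finset.sum_mul, Complex.star_def,
      Complex.conj_ofReal]
    rw [Finset.sum_comm]
    refine (Finset.sum_congr rfl fun i _ => Finset.sum_comm).trans ?_
    rw [Finset.sum_comm]
    refine Finset.sum_congr rfl fun i _ => Finset.sum_congr rfl fun j _ =>
      Finset.sum_congr rfl fun t _ => ?_
    push_cast
    ring
  rw [matRe, Matrix.map_apply, hentry, Complex.re_ofReal_mul, hsum, mul_zero]

lemma relayHeq_euclidMetric {A : Fin N → Matrix (Fin T₂) (Fin T₁ × Fin 2) ℂ}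
    (hA : SSDConditions A) (M : ℕ) (Et : ℝ) (hs hd : Fin N → ℂ) (y : Fin T₂ → ℂ)
    (x : Fin T₁ → ℂ) :
    euclidMetric (relayHeq A M Et hs hd) y x
      = (∑ t, ‖y t‖ ^ 2) + ∑ l, symbolMetric (relayHeq A M Et hs hd) y l (x l) :=
  euclidMetric_eq_sum_symbolMetric
    (fun _ _ hl a b => matRe_smul_sum_offDiagonal hA _ _ hl a b) y x

/-- Changing one symbol leaves the other summands of the split metric fixed, so symbol errors become
pairwise errors. -/
lemma symbolMetric_le_iff {A : Fin N → Matrix (Fin T₂) (Fin T₁ × Fin 2) ℂ}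
    (hA : SSDConditions A) (M : ℕ) (Et : ℝ) (hs hd : Fin N → ℂ) (y : Fin T₂ → ℂ)
    (x : Fin T₁ → ℂ) (l : Fin T₁) (s : ℂ) :
    symbolMetric (relayHeq A M Et hs hd) y l s ≤ symbolMetric (relayHeq A M Et hs hd) y l (x l)
      ↔ euclidMetric (relayHeq A M Et hs hd) y (Function.update x l s)
        ≤ euclidMetric (relayHeq A M Et hs hd) y x := by
  rw [relayHeq_euclidMetric hA, relayHeq_euclidMetric hA, add_le_add_iff_left,
    ← Finset.add_sum_erase _ _ (Finset.mem_univ l), ← Finset.add_sum_erase _ (fun l =>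
      symbolMetric (relayHeq A M Et hs hd) y l (x l)) (Finset.mem_univ l),
    Function.update_self, Finset.sum_congr rfl fun k hk => by
      rw [Function.update_of_ne (Finset.ne_of_mem_erase hk)], add_le_add_iff_right]

end PCRC

/-- Single-symbol decoding that ignores the noise covariance has full diversity in the
partially-coherent relay channel: (1) the metric it minimizes splits into single-symbol metrics,
(2) every pairwise error probability has diversity order `N`, and (3) so has the error probability
of each separately decoded symbol. Nothing is assumed about the covariance of the total noise. -/
theorem theorem6 {N T₁ T₂ : ℕ} (A : Fin N → Matrix (Fin T₂) (Fin T₁ × Fin 2) ℂ)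
    (M : ℕ) (hM : 0 < M) (S : Fin T₁ → Finset ℂ)
    (hSSD : PCRC.SSDConditions A)
    (hFD : PCRC.CoFullDiversity A S) :
    (∀ (Et : ℝ) (hs hd : Fin N → ℂ) (y : Fin T₂ → ℂ) (x : Fin T₁ → ℂ),
      PCRC.euclidMetric (PCRC.relayHeq A M Et hs hd) y x
        = (∑ t, ‖y t‖ ^ 2) + ∑ l, PCRC.symbolMetric (PCRC.relayHeq A M Et hs hd) y l (x l)) ∧
    (∀ x₁ ∈ PCRC.signalSet S, ∀ x₂ ∈ PCRC.signalSet S, x₁ ≠ x₂ →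
      PCRC.HasDiversityOrder (PCRC.relayPEP A M x₁ x₂) N) ∧
    (∀ x ∈ PCRC.signalSet S, ∀ l : Fin T₁, (∃ s ∈ S l, s ≠ x l) →
      PCRC.HasDiversityOrder (PCRC.relaySymbolError A M S x l) N) := by
  have hLI : ∀ x₁ ∈ PCRC.signalSet S, ∀ x₂ ∈ PCRC.signalSet S, x₁ ≠ x₂ →
      LinearIndependent ℂ (PCRC.codeDiff A x₁ x₂) := fun x₁ h₁ x₂ h₂ hne =>
    PCRC.linearIndependent_codeDiff (hFD x₁ h₁ x₂ h₂ hne)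
  refine ⟨PCRC.relayHeq_euclidMetric hSSD M, fun x₁ h₁ x₂ h₂ hne => ?_, fun x hx l hl => ?_⟩
  · refine PCRC.hasDiversityOrder_of_bounds (fun d hd => ?_) ?_
    · simpa only [PCRC.relayPEP, PCRC.relayErrorSet_eq] using
        PCRC.exists_relayErrorSet_le hM (hLI x₁ h₁ x₂ h₂ hne) hd
    · simpa only [PCRC.relayPEP, PCRC.relayErrorSet_eq] using
        PCRC.exists_le_relayErrorSet A hM x₁ x₂
  · have hset : ∀ Et, PCRC.relaySymbolError A M S x l Et = (PCRC.relayMeasure N T₁ T₂).real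
        (⋃ s ∈ (S l).erase (x l), PCRC.relayErrorSet A M x (Function.update x l s) Et) := by
      intro Et
      rw [PCRC.relaySymbolError]
      congr 1
      ext ω
      simp only [← PCRC.relayErrorSet_eq, Set.mem_iUnion, Finset.mem_erase, Set.mem_ofPred_eq,
        PCRC.relayChannel, PCRC.symbolMetric_le_iff hSSD, exists_prop]
      exact exists_congr fun s => by tauto
    have hmem : ∀ s ∈ (S l).erase (x l), Function.update x l s ∈ PCRC.signalSet S := by
      intro s hs k
      rcases eq_or_ne k l with rfl | hk
      · simpa using Finset.mem_of_mem_erase hs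
      · simpa [hk] using hx k
    have hne : ∀ s ∈ (S l).erase (x l), x ≠ Function.update x l s := by
      intro s hs h
      exact Finset.ne_of_mem_erase hs (by simpa using (congrFun h l).symm)
    refine PCRC.hasDiversityOrder_of_bounds (fun d hd => ?_) ?_
    -- Union bound over the finitely many wrong symbols; for the lower bound a single wrong symbol
    -- is enough.
    · choose! C hC hle using fun s hs =>
        PCRC.exists_relayErrorSet_le hM (hLI x hx _ (hmem s hs) (hne s hs)) hd
      refine ⟨∑ s ∈ (S l).erase (x l), C s, ?_, ?_⟩
      · obtain ⟨s, hs, hsx⟩ := hl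
        exact Finset.sum_pos hC ⟨s, Finset.mem_erase.2 ⟨hsx, hs⟩⟩
      · filter_upwards [(Finset.eventually_all _).2 hle] with E hE
        rw [hset, Finset.sum_mul]
        exact (measureReal_biUnion_finset_le _ _).trans (Finset.sum_le_sum hE)
    · obtain ⟨s, hs, hsx⟩ := hl
      obtain ⟨c, hc, hle⟩ := PCRC.exists_le_relayErrorSet A hM x (Function.update x l s)
      refine ⟨c, hc, ?_⟩
      filter_upwards [hle] with E hE
      rw [hset]
      exact hE.trans (measureReal_mono (Set.subset_biUnion_of_mem
        (u := fun s => PCRC.relayErrorSet A M x (Function.update x l s) E)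
        (show s ∈ ((S l).erase (x l) : Finset ℂ) from Finset.mem_erase.2 ⟨hsx, hs⟩))
        (measure_ne_top _ _))
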